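/- Let $p$ be an odd prime and $\mathbb F_q$ a finite field of characteristic $p$. For $d\ge 1$ with $p\nmid d$ let $$\mathcal F_d'=\{a_dX^d+\dots+a_0\in\mathbb F_q[X]: a_d\ne 0,\ a_{pk}=0 \text{ for } 1\le k\le \lfloor d/p\rfloor\},$$ with the uniform probability measure. Fix a nontrivial additive character $\psi$ of $\mathbb F_p$. For $n\ge 1$, $f\in\mathcal F_d'$ and $h\in\mathbb Z$ put $S_n(f,\psi^h)=\sum_{x\in\mathbb F_{q^n}}\psi(h\,\mathrm{tr}_n f(x))$, where $\mathrm{tr}_n:\mathbb F_{q^n}\to\mathbb F_p$ is the absolute trace. For $0<\beta<1$ let $\mathcal I=[-\beta/2,\beta/2]$, $|\mathcal I|=\beta$. For an integer $K\ge 0$ let $I_K^+\ge \chi_{\mathcal I}\ge I_K^-$ be the Beurling–Selberg trigonometric polynomials of degree at most $K$ of $\mathcal I$ (modulo $1$), that is $$I_K^+(x)=\beta+B_K(x-\tfrac\beta2)+B_K(-\tfrac\beta2-x),\qquad I_K^-(x)=\beta-B_K(\tfrac\beta2-x)-B_K(x+\tfrac\beta2),$$ where, with $\Delta_{K+1}(x)=\sum_{|k|\le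 K}\bigl(1-\tfrac{|k|}{K+1}\bigr)e^{2\pi i kx}$, $$B_K(x)=\frac1{K+1}\sum_{k=1}^{K}\Bigl(\frac k{K+1}-\frac12\Bigr)\Delta_{K+1}\Bigl(x-\frac k{K+1}\Bigr)+\frac{\sin 2\pi(K+1)x}{2\pi(K+1)}-\frac{\Delta_{K+1}(x)\sin 2\pi x}{2\pi}+\frac{\Delta_{K+1}(x)}{2(K+1)}.$$ Let $\widehat I_K^\pm(k)=\int_{-1/2}^{1/2}I_K^\pm(\theta)e^{-2\pi i k\theta}\,d\theta$ and define the real numbers $$S^\pm(K,f,\psi^h)=\sum_{k=1}^{K}\frac{\widehat I_K^\pm(k)S_k(f,\psi^h)+\widehat I_K^\pm(-k)S_k(f,\psi^{-h})}{q^{k/2}},\qquad S^\pm(K,C_f)=\sum_{h=1}^{p-1}S^\pm(K,f,\psi^h).$$ **Theorem.** Let $\mathcal I$ depend on $d$, with $0<|\mathcal I|<1$, in such a way that either $|\mathcal I|$ is fixed, or $|\mathcal I|\to0$ and $d|\mathcal I|\to\infty$ as $d\to\infty$. Take $K=\lfloor d/\log\log(d|\mathcal I|)\rfloor$ (the formula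 is meaningful for $d$ large). Then, for each of the two signs, the random variable $$\frac{S^\pm(K,C_f)}{\sqrt{\frac{2(p-1)}{\pi^2}\log(d|\mathcal I|)}},\qquad f\in\mathcal F_d' \text{ uniformly random},$$ converges in distribution to the standard Gaussian $N(0,1)$ as $d\to\infty$ through the integers not divisible by $p$. -/

import Mathlib

open MeasureTheory ProbabilityTheory Filter Topology Polynomial

namespace ArtinSchreier

noncomputable section

/-! ### The family of polynomials -/

/-- The polynomials `a_d X ^ d + ... + a_0` over `F` of degree exactly `d` such that
`a_{pk} = 0` for `1 ≤ k ≤ d / p`. -/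
def Family (F : Type*) [Field F] (p d : ℕ) : Set F[X] :=
  {f | f.degree = (d : WithBot ℕ) ∧ ∀ k : ℕ, 1 ≤ k → k ≤ d / p → f.coeff (p * k) = 0}

theorem Family.finite (F : Type*) [Field F] [Finite F] (p d : ℕ) : (Family F p d).Finite := by
  have hfin : Finite (Polynomial.degreeLT F (d + 1)) :=
    Finite.of_equiv _ (Polynomial.degreeLTEquiv F (d + 1)).toEquiv.symm
  refine Set.Finite.subset (Set.toFinite ((Polynomial.degreeLT F (d + 1) : Set F[X]))) ?_
  rintro f ⟨hf, -⟩
  rw [SetLike.mem_coe, Polynomial.mem_degreeLT, hf]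
  exact_mod_cast Nat.lt_succ_self d

instance (F : Type*) [Field F] [Finite F] (p d : ℕ) : Finite (Family F p d) :=
  (Family.finite F p d).to_subtype

/-- For `p ∤ d` the family is nonempty: it contains `X ^ d`. -/
instance (F : Type*) [Field F] (p : ℕ) (d : {d : ℕ // ¬ p ∣ d}) : Nonempty (Family F p d.1) := by
  refine ⟨⟨X ^ d.1, by simp, ?_⟩⟩
  intro k _ _
  rw [Polynomial.coeff_X_pow, if_neg]
  intro h
  exact d.2 ⟨k, h.symm⟩

instance (F : Type*) [Field F] (p d : ℕ) : MeasurableSpace (Family F p d) := ⊤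

/-- The uniform probability measure on the family, for `p ∤ d`. -/
def unif (F : Type*) [Field F] [Finite F] (p : ℕ) (d : {d : ℕ // ¬ p ∣ d}) :
    Measure (Family F p d.1) :=
  letI := Fintype.ofFinite (Family F p d.1)
  (PMF.uniformOfFintype (Family F p d.1)).toMeasure

instance (F : Type*) [Field F] [Finite F] (p : ℕ) (d : {d : ℕ // ¬ p ∣ d}) :
    IsProbabilityMeasure (unif F p d) := by
  unfold unif
  infer_instance

/-! ### Character sums over the extensions of the base field -/

/-- `S_n(f, ψ) = ∑ ψ (tr_n (f x))`, the sum over the elements `x` of the extension of degree `n`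
of `F`, where `tr_n` is the absolute trace to the field with `p` elements. -/
def charSum {F : Type*} [Field F] [Finite F] {p : ℕ} [Fact p.Prime] [CharP F p]
    (n : ℕ) [NeZero n] (f : F[X]) (ψ : AddChar (ZMod p) ℂ) : ℂ :=
  letI := Fintype.ofFinite (FiniteField.Extension F p n)
  ∑ x : FiniteField.Extension F p n,
    ψ (Algebra.trace (ZMod p) (FiniteField.Extension F p n) (aeval x f))

/-! ### Beurling–Selberg polynomials -/

/-- The Fejér kernel `∑_{|k| ≤ K} (1 - |k| / (K + 1)) e(k x)`, of degree `K`. -/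
def fejer (K : ℕ) (x : ℝ) : ℝ :=
  1 + 2 * ∑ k ∈ Finset.Icc 1 K, (1 - (k : ℝ) / (K + 1)) * Real.cos (2 * Real.pi * k * x)

/-- Vaaler's polynomial of degree `K`, which approximates the sawtooth function. -/
def vaaler (K : ℕ) (x : ℝ) : ℝ :=
  1 / (K + 1) * ∑ k ∈ Finset.Icc 1 K, ((k : ℝ) / (K + 1) - 1 / 2) * fejer K (x - k / (K + 1))
    + 1 / (2 * Real.pi * (K + 1)) * Real.sin (2 * Real.pi * (K + 1) * x)
    - 1 / (2 * Real.pi) * fejer K x * Real.sin (2 * Real.pi * x)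

/-- Beurling's polynomial of degree `K`, which majorizes the sawtooth function. -/
def beurling (K : ℕ) (x : ℝ) : ℝ :=
  vaaler K x + 1 / (2 * (K + 1)) * fejer K x

/-- The Beurling–Selberg polynomial `I_K^+` of degree `K` that majorizes the characteristic
function of the interval `[-β / 2, β / 2]` modulo `1`. -/
def selbergPlus (K : ℕ) (β x : ℝ) : ℝ :=
  β + beurling K (x - β / 2) + beurling K (-β / 2 - x)

/-- The Beurling–Selberg polynomial `I_K^-` of degree `K` that minorizes the characteristic
function of the interval `[-β / 2, β / 2]` modulo `1`. -/
def selbergMinus (K : ℕ) (β x : ℝ) : ℝ :=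
  β - beurling K (β / 2 - x) - beurling K (x + β / 2)

/-- `e(θ) = exp (2 π i θ)`. -/
def e (θ : ℝ) : ℂ := Complex.exp (2 * Real.pi * Complex.I * θ)

/-- The Fourier coefficient `∫_{-1/2}^{1/2} h(θ) e(-kθ) dθ`. -/
def fourierCoefficient (h : ℝ → ℝ) (k : ℤ) : ℂ :=
  ∫ θ in (-(1 / 2 : ℝ))..(1 / 2), (h θ : ℂ) * e (-k * θ)

/-! ### The smoothed statistic -/

/-- `∑_{k = 1}^K (ĥ(k) S_k(f, ψ) + ĥ(-k) S_k(f, ψ⁻¹)) / q ^ (k / 2)`, the summation index being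
written as `k = j + 1`. For `h = I_K^±` this is `S^±(K, f, ψ)`. -/
def smoothedSum {F : Type*} [Field F] [Finite F] {p : ℕ} [Fact p.Prime] [CharP F p]
    (h : ℝ → ℝ) (K : ℕ) (f : F[X]) (ψ : AddChar (ZMod p) ℂ) : ℂ :=
  ∑ j ∈ Finset.range K,
    (fourierCoefficient h (j + 1 : ℕ) * charSum (j + 1) f ψ
      + fourierCoefficient h (-(j + 1 : ℕ)) * charSum (j + 1) f ψ⁻¹)
      / (((Nat.card F : ℝ) ^ (((j + 1 : ℕ) : ℝ) / 2) : ℝ) : ℂ)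

/-- The sum over `1 ≤ m ≤ p - 1` of the smoothed sums for the characters `ψ ^ m`.
For `h = I_K^±` and nontrivial `ψ` this is `S^±(K, C_f)`. -/
def curveSum {F : Type*} [Field F] [Finite F] {p : ℕ} [Fact p.Prime] [CharP F p]
    (ψ : AddChar (ZMod p) ℂ) (h : ℝ → ℝ) (K : ℕ) (f : F[X]) : ℂ :=
  ∑ m ∈ Finset.Icc 1 (p - 1), smoothedSum h K f (ψ ^ m)

theorem conj_fourierCoefficient (h : ℝ → ℝ) (k : ℤ) :
    (starRingEnd ℂ) (fourierCoefficient h k) = fourierCoefficient h (-k) := by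
  unfold fourierCoefficient
  rw [← intervalIntegral.intervalIntegral_conj]
  refine intervalIntegral.integral_congr fun θ _ => ?_
  simp [e, ← Complex.exp_conj, Complex.conj_ofNat]

theorem conj_charSum {F : Type*} [Field F] [Finite F] {p : ℕ} [Fact p.Prime] [CharP F p]
    (n : ℕ) [NeZero n] (f : F[X]) (ψ : AddChar (ZMod p) ℂ) :
    (starRingEnd ℂ) (charSum n f ψ) = charSum n f ψ⁻¹ := by
  unfold charSum
  rw [map_sum]
  refine Finset.sum_congr rfl fun x _ => ?_
  rw [AddChar.inv_apply', AddChar.inv_apply_eq_conj]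

/-- The statistic is a real number. -/
theorem im_curveSum {F : Type*} [Field F] [Finite F] {p : ℕ} [Fact p.Prime] [CharP F p]
    (ψ : AddChar (ZMod p) ℂ) (h : ℝ → ℝ) (K : ℕ) (f : F[X]) : (curveSum ψ h K f).im = 0 := by
  rw [← Complex.conj_eq_iff_im]
  unfold curveSum smoothedSum
  simp only [map_sum]
  refine Finset.sum_congr rfl fun m _ => Finset.sum_congr rfl fun j _ => ?_
  rw [map_div₀, map_add, map_mul, map_mul, conj_fourierCoefficient, conj_fourierCoefficient,
    conj_charSum, conj_charSum, Complex.conj_ofReal, inv_inv, neg_neg, add_comm]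

/-- The statistic divided by `√((2 (p - 1) / π ^ 2) log (d β))`, as a real number
(`im_curveSum` says that taking the real part loses nothing). -/
def normalizedSum {F : Type*} [Field F] [Finite F] {p : ℕ} [Fact p.Prime] [CharP F p]
    (ψ : AddChar (ZMod p) ℂ) (h : ℝ → ℝ) (K d : ℕ) (β : ℝ) (f : F[X]) : ℝ :=
  (curveSum ψ h K f).re / √(2 * ((p : ℝ) - 1) / Real.pi ^ 2 * Real.log (d * β))

/-- The degree of the Beurling–Selberg polynomials: the integer part of
`d / log (log (d β))`. -/
def cutoff (d : ℕ) (β : ℝ) : ℕ :=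
  ⌊(d : ℝ) / Real.log (Real.log (d * β))⌋₊

end

end ArtinSchreier

namespace ArtinSchreier

open scoped BigOperators

/-! ### A central limit theorem for statistics that match an independent model -/

section CentralLimit

open scoped Nat

/-! The powers `ψ ^ m`, `1 ≤ m ≤ p - 1`, sum to the function `z` on `ZMod p` that is `p - 1` at `0`
and `-1` elsewhere (`zeroStat`). It has mean `0` and variance `p - 1`. The points of the degree `k`
extension are grouped by their minimal polynomials `P`, of degree dividing `k`. The trace of `f` at
such a point is `k / deg P` times a local trace `t_P(f)` (`trace_aeval`). Hence the statistic is `∑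
A_P z(t_P(f))` plus a part not depending on `f`, which collects the pairs with `p ∣ k / deg P`
(`curveSum_eq_linear`). That part is bounded, because `p ≥ 3` limits its `k`-th term to about `q ^
(k/3 - k/2)` (`abs_drift_le`).

The local traces at distinct points of total degree at most `d` are exactly independent and uniform
on the family. By the Chinese remainder theorem a polynomial of degree less than `d` can take any
prescribed local traces, and the Frobenius trades `a ^ p X ^ (pk)` for `a X ^ k` without changing
them, so the excluded monomials are not needed. Translating the family by such polynomials gives
uniformity (`expect_localTrace`). A mixed moment of order `r` therefore equals that of independent
uniform variables once `r K ≤ d`, and this holds eventually for each `r` because `d / K → ∞`.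

In the independent model the weights, once normalized, tend uniformly to `0`, so a Lindeberg
argument gives the Gaussian limit. Equality of the moments up to a large even order carries it over
to the family, since the exponential moments of the model are bounded
(`tendsto_charFun_of_mixed_moments`).

For the variance, there are about `q ^ m / m` points of degree `m`, each with weight about `2 m c_m
q ^ (-m/2)`. Thus `∑ A_P ^ 2` is `4 ∑ m c_m ^ 2 + O(1)`. The Beurling–Selberg coefficients satisfy
`c_m = sin (π m β) / (π m) + O(1 / K)`, which gives `(2 / π ^ 2) log (K β) + O(1)`
(`abs_variance_sub_log_le`). Finally `log (K β)` and `log (d β)` are asymptotic. -/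

theorem norm_exp_smul_sub_sum_le {c : ℂ} (hc : c.re = 0) (n : ℕ) :
    ∀ x : ℝ, 0 ≤ x →
      ‖Complex.exp (x * c) - ∑ j ∈ Finset.range n, (x * c) ^ j / (j ! : ℂ)‖
        ≤ (x * ‖c‖) ^ n / n ! := by
  induction n with
  | zero =>
    intro x _
    simp [Complex.norm_exp, hc]
  | succ n ih =>
    intro x hx
    have hlin (y : ℝ) : HasDerivAt (fun y : ℝ => (y : ℂ) * c) c y := by
      simpa using (Complex.ofRealCLM.hasDerivAt (x := y)).mul_const c
    have hd (y : ℝ) : HasDerivAt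
        (fun y : ℝ => Complex.exp (y * c) - ∑ j ∈ Finset.range (n + 1), (y * c) ^ j / (j ! : ℂ))
        (c * (Complex.exp (y * c) - ∑ j ∈ Finset.range n, (y * c) ^ j / (j ! : ℂ))) y := by
      have h1 : HasDerivAt (fun y : ℝ => Complex.exp (y * c)) (Complex.exp (y * c) * c) y :=
        (hlin y).cexp
      have h2 : HasDerivAt (fun y : ℝ => ∑ j ∈ Finset.range n, (y * c) ^ (j + 1) / ((j + 1)! : ℂ))
          (∑ j ∈ Finset.range n, c * ((y * c) ^ j / (j ! : ℂ))) y := by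
        refine HasDerivAt.fun_sum fun j _ => ?_
        have h3 := ((hlin y).pow (j + 1)).div_const ((j + 1)! : ℂ)
        refine h3.congr_deriv ?_
        have : (j ! : ℂ) ≠ 0 := by exact_mod_cast Nat.factorial_ne_zero j
        have h4 : ((j : ℂ) + 1) ≠ 0 := by exact_mod_cast Nat.succ_ne_zero j
        rw [Nat.factorial_succ]
        push_cast
        field_simp
      have h5 := h1.sub (h2.add_const 1)
      refine (h5.congr_deriv ?_).congr_of_eventuallyEq (Eventually.of_forall fun y => ?_)
      · rw [← Finset.mul_sum]; ring
      · simp [Finset.sum_range_succ']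
    have hB (y : ℝ) : HasDerivAt (fun y : ℝ => (y * ‖c‖) ^ (n + 1) / (n + 1)!)
        (‖c‖ * ((y * ‖c‖) ^ n / n !)) y := by
      have h3 := (((hasDerivAt_id y).mul_const ‖c‖).pow (n + 1)).div_const ((n + 1)! : ℝ)
      refine h3.congr_deriv ?_
      have : (n ! : ℝ) ≠ 0 := by exact_mod_cast Nat.factorial_ne_zero n
      have h4 : ((n : ℝ) + 1) ≠ 0 := by exact_mod_cast Nat.succ_ne_zero n
      rw [Nat.factorial_succ]
      push_cast
      simp only [id]
      field_simp
    -- The remainder of order `n + 1` vanishes at `0` and its derivative is `c` times the remainder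
    -- of order `n`. The induction hypothesis therefore bounds it by the derivative of the majorant.
    refine image_norm_le_of_norm_deriv_right_le_deriv_boundary (a := 0) (b := x)
      (fun y _ => (hd y).continuousAt.continuousWithinAt) (fun y _ => (hd y).hasDerivWithinAt)
      ?_ hB (fun y hy => ?_) ⟨hx, le_rfl⟩
    · simp [Finset.sum_range_succ']
    · rw [norm_mul]
      exact mul_le_mul_of_nonneg_left (ih y hy.1) (norm_nonneg _)

theorem norm_exp_mul_I_sub_sum_le (n : ℕ) (x : ℝ) :
    ‖Complex.exp (x * Complex.I) - ∑ j ∈ Finset.range n, (x * Complex.I) ^ j / (j ! : ℂ)‖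
      ≤ |x| ^ n / n ! := by
  simpa using norm_exp_smul_sub_sum_le (c := x * Complex.I) (by simp) n 1 zero_le_one

/-- The factors are exchanged one at a time; all the others have norm at most `1`. -/
theorem norm_prod_sub_prod_le {ι : Type*} (s : Finset ι) (a b : ι → ℂ)
    (ha : ∀ i ∈ s, ‖a i‖ ≤ 1) (hb : ∀ i ∈ s, ‖b i‖ ≤ 1) :
    ‖∏ i ∈ s, a i - ∏ i ∈ s, b i‖ ≤ ∑ i ∈ s, ‖a i - b i‖ := by
  classical
  induction s using Finset.induction_on with
  | empty => simp
  | insert i s hi ih =>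
    rw [Finset.prod_insert hi, Finset.prod_insert hi, Finset.sum_insert hi]
    have h1 : a i * ∏ j ∈ s, a j - b i * ∏ j ∈ s, b j
        = (a i - b i) * ∏ j ∈ s, a j + b i * (∏ j ∈ s, a j - ∏ j ∈ s, b j) := by ring
    rw [h1]
    refine (norm_add_le _ _).trans (add_le_add ?_ ?_)
    · rw [norm_mul, norm_prod]
      exact mul_le_of_le_one_right (norm_nonneg _) (Finset.prod_le_one (fun _ _ => norm_nonneg _)
        fun j hj => ha j (Finset.mem_insert_of_mem hj))
    · rw [norm_mul]
      exact (mul_le_of_le_one_left (norm_nonneg _) (hb i (Finset.mem_insert_self i s))).trans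
        (ih (fun j hj => ha j (Finset.mem_insert_of_mem hj))
          fun j hj => hb j (Finset.mem_insert_of_mem hj))

theorem expect_pi_prod {ι E 𝕜 : Type*} [Fintype ι] [DecidableEq ι] [Fintype E] [Field 𝕜]
    [CharZero 𝕜] (g : ι → E → 𝕜) :
    𝔼 ω : ι → E, ∏ i, g i (ω i) = ∏ i, 𝔼 x, g i x := by
  simp only [Fintype.expect_eq_sum_div_card]
  rw [Finset.prod_div_distrib, Fintype.prod_sum]
  simp

theorem norm_expect_le {Ω : Type*} [Fintype Ω] (g : Ω → ℂ) (b : Ω → ℝ) (h : ∀ ω, ‖g ω‖ ≤ b ω) :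
    ‖𝔼 ω, g ω‖ ≤ 𝔼 ω, b ω := by
  rw [Fintype.expect_eq_sum_div_card, Fintype.expect_eq_sum_div_card, norm_div,
    RCLike.norm_natCast]
  gcongr
  exact (norm_sum_le _ _).trans (Finset.sum_le_sum fun ω _ => h ω)

/-! ### Characteristic function and exponential moments of the independent model -/

section Model

variable {ι E : Type*} [Fintype ι] [DecidableEq ι] [Fintype E] [Nonempty E] {z : E → ℝ} {v B : ℝ}

/-- Both the characteristic function and the Gaussian one agree with `1 - v s ^ 2 / 2` up to a
third-order error, which accounts for the factor `2`. -/
theorem norm_expect_exp_sub_le (h0 : 𝔼 x, z x = 0) (h2 : 𝔼 x, z x ^ 2 = v) (hB : ∀ x, |z x| ≤ B)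
    {s : ℝ} (hs : |s| * B ≤ 1) :
    ‖𝔼 x, Complex.exp ((s * z x : ℝ) * Complex.I) - (Real.exp (-(v * s ^ 2 / 2)) : ℂ)‖
      ≤ 2 * B ^ 3 * |s| ^ 3 := by
  have hB0 : 0 ≤ B := (abs_nonneg _).trans (hB (Classical.arbitrary E))
  have hv0 : 0 ≤ v := h2 ▸ Finset.expect_nonneg fun x _ => sq_nonneg _
  have hvB : v ≤ B ^ 2 := by
    rw [← h2]
    refine (Finset.expect_le_expect fun x _ => ?_).trans_eq (Fintype.expect_const (B ^ 2))
    exact sq_le_sq' (neg_le_of_abs_le (hB x)) (le_of_abs_le (hB x))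
  have e1 : 𝔼 x, (∑ j ∈ Finset.range 3, ((s * z x : ℝ) * Complex.I) ^ j / (j ! : ℂ))
      = ((1 - v * s ^ 2 / 2 : ℝ) : ℂ) := by
    have : ∀ x, (∑ j ∈ Finset.range 3, ((s * z x : ℝ) * Complex.I) ^ j / (j ! : ℂ))
        = ((1 - (s ^ 2 / 2) * z x ^ 2 : ℝ) : ℂ) + ((s * z x : ℝ) : ℂ) * Complex.I := by
      intro x
      simp only [Finset.sum_range_succ, Finset.sum_range_zero, Nat.factorial]
      push_cast
      ring_nf
      rw [Complex.I_sq]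
      ring
    simp_rw [this]
    rw [Finset.expect_add_distrib, ← Finset.expect_mul]
    rw [← Complex.ofReal_expect, ← Complex.ofReal_expect, ← Finset.mul_expect, h0,
      Finset.expect_sub_distrib, ← Finset.mul_expect, h2, Fintype.expect_const]
    push_cast
    ring
  have b1 : ‖𝔼 x, Complex.exp ((s * z x : ℝ) * Complex.I) - ((1 - v * s ^ 2 / 2 : ℝ) : ℂ)‖
      ≤ B ^ 3 * |s| ^ 3 := by
    rw [← e1, ← Finset.expect_sub_distrib]
    refine (norm_expect_le _ (fun _ => B ^ 3 * |s| ^ 3) fun x => ?_).trans_eq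
      (Fintype.expect_const _)
    refine (norm_exp_mul_I_sub_sum_le 3 _).trans ?_
    rw [abs_mul, mul_pow]
    refine (div_le_self (by positivity) (by norm_num [Nat.factorial])).trans ?_
    rw [mul_comm]
    gcongr
    exact hB x
  have hsB : s ^ 2 * B ^ 2 ≤ 1 := by
    rw [← sq_abs s, ← mul_pow]
    exact pow_le_one₀ (by positivity) hs
  have hvs : v * s ^ 2 ≤ 1 := by nlinarith [sq_nonneg s]
  have b2 : ‖((1 - v * s ^ 2 / 2 : ℝ) : ℂ) - (Real.exp (-(v * s ^ 2 / 2)) : ℂ)‖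
      ≤ B ^ 3 * |s| ^ 3 := by
    rw [← Complex.ofReal_sub, Complex.norm_real, Real.norm_eq_abs, abs_sub_comm]
    have h := Real.abs_exp_sub_one_sub_id_le (x := -(v * s ^ 2 / 2)) (by
      rw [abs_neg, abs_of_nonneg (by positivity)]; linarith)
    have h' : Real.exp (-(v * s ^ 2 / 2)) - (1 - v * s ^ 2 / 2)
      = Real.exp (-(v * s ^ 2 / 2)) - 1 - -(v * s ^ 2 / 2) := by ring
    rw [h']
    refine h.trans ?_
    have h3 : (v * s ^ 2) ≤ B ^ 2 * |s| ^ 2 := by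
      rw [sq_abs]; gcongr
    have h4 : (v * s ^ 2) ^ 2 ≤ (B ^ 2 * |s| ^ 2) ^ 2 := by gcongr
    -- The error of the Gaussian factor is of fourth order in `B * |s|`; one factor is given up
    -- through `|s| * B ≤ 1`.
    have h5 : (B ^ 2 * |s| ^ 2) ^ 2 = (B ^ 3 * |s| ^ 3) * (|s| * B) := by ring
    have h6 : (B ^ 3 * |s| ^ 3) * (|s| * B) ≤ (B ^ 3 * |s| ^ 3) * 1 := by gcongr
    nlinarith [sq_nonneg (v * s ^ 2)]
  calc _ ≤ _ := norm_sub_le_norm_sub_add_norm_sub _ ((1 - v * s ^ 2 / 2 : ℝ) : ℂ) _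
    _ ≤ _ := by linarith

/-- This is `exp y ≤ 1 + y + y ^ 2` for `|y| ≤ 1`, averaged with the linear term vanishing. -/
theorem expect_exp_le (h0 : 𝔼 x, z x = 0) (h2 : 𝔼 x, z x ^ 2 = v) (hB : ∀ x, |z x| ≤ B)
    {s : ℝ} (hs : |s| * B ≤ 1) : 𝔼 x, Real.exp (s * z x) ≤ Real.exp (v * s ^ 2) := by
  have h : 𝔼 x, Real.exp (s * z x) ≤ 𝔼 x, (1 + s * z x + s ^ 2 * z x ^ 2) := by
    refine Finset.expect_le_expect fun x _ => ?_
    have h := Real.abs_exp_sub_one_sub_id_le (x := s * z x) (by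
      rw [abs_mul]
      exact (mul_le_mul_of_nonneg_left (hB x) (abs_nonneg s)).trans hs)
    have := le_of_abs_le h
    nlinarith
  rw [Finset.expect_add_distrib, Finset.expect_add_distrib, ← Finset.mul_expect,
    ← Finset.mul_expect, h0, h2, Fintype.expect_const] at h
  have := Real.add_one_le_exp (v * s ^ 2)
  linarith

/-- By independence both sides are products over the coordinates. The errors add up to a multiple of
`∑ |a i| ^ 3`, which is at most `ε ∑ a i ^ 2`: Lindeberg's argument. -/
theorem norm_charFun_model_sub_le (h0 : 𝔼 x, z x = 0) (h2 : 𝔼 x, z x ^ 2 = v)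
    (hB : ∀ x, |z x| ≤ B) {a : ι → ℝ} {ε t : ℝ} (ha : ∀ i, |a i| ≤ ε) (ht : |t| * ε * B ≤ 1) :
    ‖𝔼 ω : ι → E, Complex.exp ((t * ∑ i, a i * z (ω i) : ℝ) * Complex.I)
        - (Real.exp (-(v * ∑ i, a i ^ 2) * t ^ 2 / 2) : ℂ)‖
      ≤ 2 * B ^ 3 * |t| ^ 3 * ε * ∑ i, a i ^ 2 := by
  have hB0 : 0 ≤ B := (abs_nonneg _).trans (hB (Classical.arbitrary E))
  have hv0 : 0 ≤ v := h2 ▸ Finset.expect_nonneg fun x _ => sq_nonneg _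
  have e1 : ∀ ω : ι → E, Complex.exp ((t * ∑ i, a i * z (ω i) : ℝ) * Complex.I)
      = ∏ i, Complex.exp (((t * a i) * z (ω i) : ℝ) * Complex.I) := by
    intro ω
    rw [← Complex.exp_sum, ← Finset.sum_mul, ← Complex.ofReal_sum, Finset.mul_sum]
    simp only [mul_assoc]
  have e2 : (Real.exp (-(v * ∑ i, a i ^ 2) * t ^ 2 / 2) : ℂ)
      = ∏ i, (Real.exp (-(v * (t * a i) ^ 2 / 2)) : ℂ) := by
    rw [← Complex.ofReal_prod, ← Real.exp_sum]
    congr 2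
    rw [Finset.mul_sum, ← Finset.sum_neg_distrib, Finset.sum_mul, Finset.sum_div]
    exact Finset.sum_congr rfl fun i _ => by ring
  simp_rw [e1]
  rw [e2, expect_pi_prod (fun i x => Complex.exp (((t * a i) * z x : ℝ) * Complex.I))]
  refine (norm_prod_sub_prod_le _ _ _ (fun i _ => ?_) fun i _ => ?_).trans ?_
  · refine (norm_expect_le _ (fun _ => (1 : ℝ)) fun x => ?_).trans_eq (Fintype.expect_const _)
    rw [Complex.norm_exp_ofReal_mul_I]
  · rw [Complex.norm_real, Real.norm_eq_abs, Real.abs_exp, Real.exp_le_one_iff]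
    have : 0 ≤ v * (t * a i) ^ 2 / 2 := by positivity
    linarith
  · rw [Finset.mul_sum]
    refine Finset.sum_le_sum fun i _ => ?_
    refine (norm_expect_exp_sub_le h0 h2 hB ?_).trans ?_
    · rw [abs_mul]
      refine le_trans ?_ ht
      gcongr
      exact ha i
    · rw [abs_mul, mul_pow]
      have : |a i| ^ 3 ≤ ε * a i ^ 2 := by
        rw [← sq_abs (a i), pow_succ']
        exact mul_le_mul_of_nonneg_right (ha i) (by positivity)
      calc 2 * B ^ 3 * (|t| ^ 3 * |a i| ^ 3) ≤ 2 * B ^ 3 * (|t| ^ 3 * (ε * a i ^ 2)) := by gcongr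
        _ = _ := by ring

theorem expect_exp_model_le (h0 : 𝔼 x, z x = 0) (h2 : 𝔼 x, z x ^ 2 = v)
    (hB : ∀ x, |z x| ≤ B) {a : ι → ℝ} {ε t : ℝ} (ha : ∀ i, |a i| ≤ ε) (ht : |t| * ε * B ≤ 1) :
    𝔼 ω : ι → E, Real.exp (t * ∑ i, a i * z (ω i)) ≤ Real.exp (v * (∑ i, a i ^ 2) * t ^ 2) := by
  have hB0 : 0 ≤ B := (abs_nonneg _).trans (hB (Classical.arbitrary E))
  have e1 : ∀ ω : ι → E, Real.exp (t * ∑ i, a i * z (ω i))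
      = ∏ i, Real.exp ((t * a i) * z (ω i)) := by
    intro ω
    rw [← Real.exp_sum, Finset.mul_sum]
    simp only [mul_assoc]
  simp_rw [e1]
  rw [expect_pi_prod (fun i x => Real.exp ((t * a i) * z x)), Finset.mul_sum, Finset.sum_mul,
    Real.exp_sum]
  refine Finset.prod_le_prod (fun i _ => Finset.expect_nonneg fun x _ => (Real.exp_pos _).le)
    fun i _ => ?_
  refine (expect_exp_le h0 h2 hB ?_).trans_eq (by ring_nf)
  rw [abs_mul]
  refine le_trans ?_ ht
  gcongr
  exact ha i

end Model

/-- Since `r` is even, the Taylor remainder is bounded by a genuine moment rather than an absolute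
one, so the bound too is determined by the moments. -/
theorem norm_charFun_sub_sum_moments_le {Ω : Type*} [Fintype Ω] (X : Ω → ℝ) {r : ℕ} (hr : Even r)
    (t : ℝ) :
    ‖𝔼 ω, Complex.exp ((t * X ω : ℝ) * Complex.I)
        - ∑ j ∈ Finset.range r, (t * Complex.I) ^ j / (j ! : ℂ) * ((𝔼 ω, X ω ^ j : ℝ) : ℂ)‖
      ≤ t ^ r / r ! * 𝔼 ω, X ω ^ r := by
  have e1 : ∑ j ∈ Finset.range r, (t * Complex.I) ^ j / (j ! : ℂ) * ((𝔼 ω, X ω ^ j : ℝ) : ℂ)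
      = 𝔼 ω, ∑ j ∈ Finset.range r, ((t * X ω : ℝ) * Complex.I) ^ j / (j ! : ℂ) := by
    rw [Finset.expect_sum_comm]
    refine Finset.sum_congr rfl fun j _ => ?_
    rw [Complex.ofReal_expect, Finset.mul_expect]
    refine Finset.expect_congr rfl fun ω _ => ?_
    push_cast
    ring
  rw [e1, ← Finset.expect_sub_distrib, Finset.mul_expect]
  refine norm_expect_le _ _ fun ω => (norm_exp_mul_I_sub_sum_le r _).trans_eq ?_
  rw [hr.pow_abs, mul_pow]
  ring

/-- If the moments of `X` and `Y` up to an even order `r` agree, their characteristic functions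
differ by an amount that is controlled by the exponential moments of `Y`. -/
theorem norm_charFun_sub_charFun_le {Ω Ω' : Type*} [Fintype Ω] [Fintype Ω'] (X : Ω → ℝ)
    (Y : Ω' → ℝ) {r : ℕ} (hr : Even r) (h : ∀ j ≤ r, 𝔼 ω, X ω ^ j = 𝔼 ω, Y ω ^ j) (t : ℝ) :
    ‖𝔼 ω, Complex.exp ((t * X ω : ℝ) * Complex.I) - 𝔼 ω, Complex.exp ((t * Y ω : ℝ) * Complex.I)‖
      ≤ 2 / 2 ^ r * (𝔼 ω, Real.exp (2 * t * Y ω) + 𝔼 ω, Real.exp (-(2 * t) * Y ω)) := by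
  have hX := norm_charFun_sub_sum_moments_le X hr t
  have hY := norm_charFun_sub_sum_moments_le Y hr t
  rw [Finset.sum_congr rfl fun j hj => by rw [h j (Finset.mem_range.1 hj).le], h r le_rfl] at hX
  -- Doubling the argument gains `2 ^ (-r)`, and `|y| ^ r / r!` is at most `exp |y|`, hence at most
  -- `exp y + exp (-y)`.
  have key : t ^ r / r ! * 𝔼 ω, Y ω ^ r
      ≤ 1 / 2 ^ r * (𝔼 ω, Real.exp (2 * t * Y ω) + 𝔼 ω, Real.exp (-(2 * t) * Y ω)) := by
    rw [← Finset.expect_add_distrib, Finset.mul_expect, Finset.mul_expect]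
    refine Finset.expect_le_expect fun ω _ => ?_
    have h1 : t ^ r / r ! * Y ω ^ r = 1 / 2 ^ r * (|2 * t * Y ω| ^ r / r !) := by
      rw [hr.pow_abs, mul_pow, mul_pow]
      field_simp
    rw [h1]
    gcongr
    refine (Real.pow_div_factorial_le_exp _ (abs_nonneg _) r).trans ?_
    rcases abs_cases (2 * t * Y ω) with ⟨h, _⟩ | ⟨h, _⟩ <;> rw [h]
    · exact le_add_of_nonneg_right (Real.exp_pos _).le
    · rw [neg_mul]
      exact le_add_of_nonneg_left (Real.exp_pos _).le
  calc _ ≤ _ := norm_sub_le_norm_sub_add_norm_sub _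
        (∑ j ∈ Finset.range r, (t * Complex.I) ^ j / (j ! : ℂ) * ((𝔼 ω, Y ω ^ j : ℝ) : ℂ)) _
    _ ≤ _ := by
      rw [norm_sub_rev (∑ j ∈ Finset.range r, _)]
      refine (add_le_add hX hY).trans ?_
      rw [← two_mul]
      refine (mul_le_mul_of_nonneg_left key zero_le_two).trans_eq ?_
      ring

/-- Moments of linear statistics agree as soon as the mixed moments of the variables do. -/
theorem expect_sum_pow_eq {Ω Ω' ι : Type*} [Fintype Ω] [Fintype Ω'] [Fintype ι]
    (U : Ω → ι → ℝ) (V : Ω' → ι → ℝ) (a : ι → ℝ) (r : ℕ)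
    (h : ∀ κ : Fin r → ι, 𝔼 ω, ∏ j, U ω (κ j) = 𝔼 ω, ∏ j, V ω (κ j)) :
    𝔼 ω, (∑ i, a i * U ω i) ^ r = 𝔼 ω, (∑ i, a i * V ω i) ^ r := by
  simp_rw [Fintype.sum_pow, Finset.prod_mul_distrib, Finset.expect_sum_comm, ← Finset.mul_expect, h]

/-- For given `t` and precision a finite order of moments suffices, because the exponential moments
of the model at `±2t` are bounded along `l`. The order can thus be fixed before the index goes to
its limit, so no uniformity in `r` is required in `hmom`. -/
theorem tendsto_charFun_of_mixed_moments {D E : Type*} {l : Filter D} {Ω ι : D → Type*}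
    [∀ d, Fintype (Ω d)] [∀ d, Nonempty (Ω d)] [∀ d, Fintype (ι d)]
    [∀ d, DecidableEq (ι d)] [Fintype E] [Nonempty E]
    {z : E → ℝ} {v B : ℝ} (h0 : 𝔼 x, z x = 0) (h2 : 𝔼 x, z x ^ 2 = v) (hB : ∀ x, |z x| ≤ B)
    (hv : 0 < v) (W : ∀ d, Ω d → ι d → E) (a : ∀ d, ι d → ℝ) {ε δ : D → ℝ}
    (ha : ∀ᶠ d in l, ∀ i, |a d i| ≤ ε d) (hε : Tendsto ε l (𝓝 0))
    (hvar : Tendsto (fun d => v * ∑ i, a d i ^ 2) l (𝓝 1)) (hδ : Tendsto δ l (𝓝 0))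
    (hmom : ∀ r : ℕ, ∀ᶠ d in l, ∀ κ : Fin r → ι d,
      𝔼 f, ∏ j, z (W d f (κ j)) = 𝔼 ω : ι d → E, ∏ j, z (ω (κ j))) (t : ℝ) :
    Tendsto (fun d => 𝔼 f, Complex.exp ((t * (∑ i, a d i * z (W d f i) + δ d) : ℝ) * Complex.I))
      l (𝓝 (Complex.exp (-(t : ℂ) ^ 2 / 2))) := by
  have hsmall (s : ℝ) : ∀ᶠ d in l, |s| * ε d * B ≤ 1 := by
    have : Tendsto (fun d => |s| * ε d * B) l (𝓝 (|s| * 0 * B)) := (hε.const_mul _).mul_const _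
    rw [mul_zero, zero_mul] at this
    exact this.eventually_le_const one_pos
  have hmodel : Tendsto (fun d => 𝔼 ω : ι d → E,
      Complex.exp ((t * ∑ i, a d i * z (ω i) : ℝ) * Complex.I)) l
      (𝓝 (Complex.exp (-(t : ℂ) ^ 2 / 2))) := by
    have h1 : Tendsto (fun d => (Real.exp (-(v * ∑ i, a d i ^ 2) * t ^ 2 / 2) : ℂ)) l
        (𝓝 (Complex.exp (-(t : ℂ) ^ 2 / 2))) := by
      have h3 : Complex.exp (-(t : ℂ) ^ 2 / 2) = (Real.exp (-1 * t ^ 2 / 2) : ℂ) := by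
        push_cast
        ring_nf
      rw [h3]
      refine (Complex.continuous_ofReal.tendsto _).comp ((Real.continuous_exp.tendsto _).comp ?_)
      exact ((hvar.neg.mul_const _).div_const _)
    refine (tendsto_iff_of_dist ?_).2 h1
    have h4 : Tendsto (fun d => 2 * B ^ 3 * |t| ^ 3 * ε d * ((v * ∑ i, a d i ^ 2) / v)) l (𝓝 0) := by
      have := (hε.const_mul (2 * B ^ 3 * |t| ^ 3)).mul (hvar.div_const v)
      simpa using this
    refine squeeze_zero' (Eventually.of_forall fun _ => dist_nonneg) ?_ h4
    filter_upwards [ha, hsmall t] with d had ht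
    rw [dist_eq_norm, mul_div_cancel_left₀ _ hv.ne']
    exact norm_charFun_model_sub_le h0 h2 hB had ht
  have hmain : Tendsto (fun d => 𝔼 f,
      Complex.exp ((t * ∑ i, a d i * z (W d f i) : ℝ) * Complex.I)) l
      (𝓝 (Complex.exp (-(t : ℂ) ^ 2 / 2))) := by
    refine (tendsto_iff_of_dist ?_).2 hmodel
    rw [Metric.tendsto_nhds]
    intro η hη
    -- Bounds the exponential moments at `±2t` as soon as the variance is at most `2`.
    set M := Real.exp (2 * (2 * t) ^ 2) with hM
    have hM0 : 0 < M := Real.exp_pos _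
    -- The moments are matched up to order `2 * n`; the resulting error is at most `2 * (1 / 2) ^ n
    -- * (M + M)`.
    obtain ⟨n, hn⟩ : ∃ n : ℕ, (1 / 2 : ℝ) ^ n < η / (4 * M) :=
      exists_pow_lt_of_lt_one (by positivity) (by norm_num)
    have hmom' : ∀ᶠ d in l, ∀ r ≤ 2 * n, ∀ κ : Fin r → ι d,
        𝔼 f, ∏ j, z (W d f (κ j)) = 𝔼 ω : ι d → E, ∏ j, z (ω (κ j)) := by
      have := (Set.finite_Iic (2 * n)).eventually_all (l := l)
        (p := fun r d => ∀ κ : Fin r → ι d,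
          𝔼 f, ∏ j, z (W d f (κ j)) = 𝔼 ω : ι d → E, ∏ j, z (ω (κ j)))
      exact this.2 fun r _ => hmom r
    filter_upwards [ha, hsmall (2 * t), hmom', hvar.eventually_le_const one_lt_two]
      with d had ht hd hvd
    rw [dist_zero_right, Real.norm_eq_abs, abs_of_nonneg dist_nonneg, dist_eq_norm]
    refine (norm_charFun_sub_charFun_le (fun f => ∑ i, a d i * z (W d f i))
      (fun ω : ι d → E => ∑ i, a d i * z (ω i)) (even_two_mul n) (fun j hj => ?_) t).trans_lt ?_
    · exact expect_sum_pow_eq _ _ _ _ (hd j hj)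
    · have hb : ∀ s : ℝ, |s| * ε d * B ≤ 1 → s ^ 2 = (2 * t) ^ 2 →
          𝔼 ω : ι d → E, Real.exp (s * ∑ i, a d i * z (ω i)) ≤ M := by
        intro s hs hs2
        refine (expect_exp_model_le h0 h2 hB had hs).trans ?_
        rw [hs2, hM]
        gcongr
      have b1 := hb (2 * t) ht rfl
      have b2 := hb (-(2 * t)) (by rwa [abs_neg]) (by ring)
      have hpow : (2 : ℝ) / 2 ^ (2 * n) ≤ 2 * (1 / 2) ^ n := by
        rw [div_pow, one_pow, mul_one_div]
        gcongr
        · norm_num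
        · omega
      calc _ ≤ 2 * (1 / 2) ^ n * (M + M) := by gcongr
        _ = (1 / 2) ^ n * (4 * M) := by ring
        _ < η := by rwa [lt_div_iff₀ (by positivity)] at hn
  -- The deterministic shift only multiplies the characteristic function by a phase tending to `1`.
  have hshift : Tendsto (fun d => Complex.exp ((t * δ d : ℝ) * Complex.I)) l (𝓝 1) := by
    have h1 : Continuous fun x : ℝ => Complex.exp ((t * x : ℝ) * Complex.I) := by fun_prop
    have := (h1.tendsto 0).comp hδ
    simpa [Function.comp_def] using this
  have := hmain.mul hshift
  rw [mul_one] at this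
  refine this.congr fun d => ?_
  rw [Finset.expect_mul]
  refine Finset.expect_congr rfl fun f _ => ?_
  rw [← Complex.exp_add]
  push_cast
  ring_nf

end CentralLimit

/-! ### Closed points of the affine line and local traces -/

section ClosedPoints

variable {F : Type*} [Field F]

theorem finite_closedPoints (F : Type*) [Field F] [Finite F] (K : ℕ) :
    {P : F[X] | P.Monic ∧ Irreducible P ∧ P.natDegree ≤ K}.Finite := by
  have hfin : Finite (Polynomial.degreeLT F (K + 1)) :=
    Finite.of_equiv _ (Polynomial.degreeLTEquiv F (K + 1)).toEquiv.symm
  refine Set.Finite.subset (Set.toFinite ((Polynomial.degreeLT F (K + 1) : Set F[X]))) ?_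
  rintro P ⟨-, hP, hK⟩
  rw [SetLike.mem_coe, Polynomial.mem_degreeLT]
  refine degree_le_natDegree.trans_lt ?_
  exact_mod_cast Nat.lt_succ_of_le hK

/-- The monic irreducible polynomials of degree at most `K`. -/
noncomputable def closedPoints (F : Type*) [Field F] [Finite F] (K : ℕ) : Finset F[X] :=
  (finite_closedPoints F K).toFinset

@[simp]
theorem mem_closedPoints [Finite F] {K : ℕ} {P : F[X]} :
    P ∈ closedPoints F K ↔ P.Monic ∧ Irreducible P ∧ P.natDegree ≤ K := by
  simp [closedPoints]

/-- The absolute trace of the value of a polynomial at the closed point defined by `P`. -/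
noncomputable def localTrace (p : ℕ) [Fact p.Prime] [CharP F p] (P : F[X]) : F[X] →+ ZMod p :=
  letI := ZMod.algebra F p
  (Algebra.trace (ZMod p) (AdjoinRoot P)).toAddMonoidHom.comp (AdjoinRoot.mk P).toAddMonoidHom

variable {p : ℕ} [Fact p.Prime] [CharP F p]

theorem localTrace_apply [Algebra (ZMod p) F] (P f : F[X]) :
    localTrace p P f = Algebra.trace (ZMod p) (AdjoinRoot P) (AdjoinRoot.mk P f) := by
  have : ‹Algebra (ZMod p) F› = ZMod.algebra F p := Subsingleton.elim _ _
  subst this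
  rfl

theorem localTrace_eq_of_dvd_sub {P f g : F[X]} (h : P ∣ f - g) :
    localTrace p P f = localTrace p P g := by
  let := ZMod.algebra F p
  rw [localTrace_apply, localTrace_apply, AdjoinRoot.mk_eq_mk.2 h]

variable [Finite F]

theorem finite_adjoinRoot {P : F[X]} (hP : Irreducible P) : Finite (AdjoinRoot P) :=
  have := (AdjoinRoot.powerBasis hP.ne_zero).finite
  Module.finite_of_finite F

/-- The Frobenius is an automorphism of the residue field over `ZMod p`, and the trace is invariant
under automorphisms. -/
theorem localTrace_pow {P : F[X]} (hP : Irreducible P) (f : F[X]) :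
    localTrace p P (f ^ p) = localTrace p P f := by
  let := ZMod.algebra F p
  have := Fact.mk hP
  have := finite_adjoinRoot hP
  have := Algebra.IsAlgebraic.of_finite (ZMod p) (AdjoinRoot P)
  rw [localTrace_apply, localTrace_apply, map_pow]
  have h := Algebra.trace_eq_of_algEquiv
    (FiniteField.frobeniusAlgEquivOfAlgebraic (ZMod p) (AdjoinRoot P)) (AdjoinRoot.mk P f)
  simpa [ZMod.card] using h

theorem localTrace_surjective {P : F[X]} (hP : Irreducible P) :
    Function.Surjective (localTrace p P) := by
  let := ZMod.algebra F p
  have := Fact.mk hP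
  have := finite_adjoinRoot hP
  intro b
  obtain ⟨a, ha⟩ := Algebra.trace_surjective (ZMod p) (AdjoinRoot P) b
  obtain ⟨f, rfl⟩ := AdjoinRoot.mk_surjective a
  exact ⟨f, by rw [localTrace_apply, ha]⟩

theorem natDegree_minpoly_dvd (n : ℕ) [NeZero n] (y : FiniteField.Extension F p n) :
    (minpoly F y).natDegree ∣ n := by
  have h := minpoly.degree_dvd (K := F) (Algebra.IsIntegral.isIntegral y)
  rwa [FiniteField.finrank_extension] at h

/-- The trace of the value at a point of an extension, in terms of the closed point below it. -/
theorem trace_aeval (n : ℕ) [NeZero n] (y : FiniteField.Extension F p n) (f : F[X]) :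
    Algebra.trace (ZMod p) (FiniteField.Extension F p n) (aeval y f)
      = (n / (minpoly F y).natDegree) • localTrace p (minpoly F y) f := by
  let := ZMod.algebra F p
  have hirr : Irreducible (minpoly F y) := minpoly.irreducible (Algebra.IsIntegral.isIntegral y)
  have := Fact.mk hirr
  have := finite_adjoinRoot hirr
  -- The residue field at the closed point is embedded as `F(y)`. The trace then factors through it,
  -- and on an element coming from it the upper trace is multiplication by the relative degree.
  let φ : AdjoinRoot (minpoly F y) →ₐ[F] FiniteField.Extension F p n :=
    AdjoinRoot.liftAlgHom (minpoly F y) (Algebra.ofId F _) y (minpoly.aeval F y)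
  let := φ.toRingHom.toAlgebra
  have : IsScalarTower F (AdjoinRoot (minpoly F y)) (FiniteField.Extension F p n) :=
    .of_algebraMap_eq fun x => (φ.commutes x).symm
  have : IsScalarTower (ZMod p) (AdjoinRoot (minpoly F y)) (FiniteField.Extension F p n) :=
    .of_algebraMap_eq' (Subsingleton.elim _ _)
  have hval : algebraMap (AdjoinRoot (minpoly F y)) (FiniteField.Extension F p n)
      (AdjoinRoot.mk _ f) = aeval y f := by
    change φ (AdjoinRoot.mk _ f) = _
    simp only [φ]
    rfl
  have hfin : Module.Finite (AdjoinRoot (minpoly F y)) (FiniteField.Extension F p n) := .of_finite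
  have hdeg : Module.finrank F (AdjoinRoot (minpoly F y)) = (minpoly F y).natDegree := by
    rw [(AdjoinRoot.powerBasis hirr.ne_zero).finrank, AdjoinRoot.powerBasis_dim]
  have hmul := Module.finrank_mul_finrank F (AdjoinRoot (minpoly F y))
    (FiniteField.Extension F p n)
  rw [hdeg, FiniteField.finrank_extension] at hmul
  rw [← hval, ← Algebra.trace_trace (S := AdjoinRoot (minpoly F y)), Algebra.trace_algebraMap,
    map_nsmul, localTrace_apply]
  congr 1
  exact Nat.eq_div_of_mul_eq_right hirr.natDegree_pos.ne' hmul

open Classical in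
/-- A sum over the points of an extension, as a sum over closed points. -/
theorem sum_minpoly {M : Type*} [AddCommMonoid M] (n : ℕ) [NeZero n] {K : ℕ} (hn : n ≤ K)
    [Fintype (FiniteField.Extension F p n)] (G : F[X] → M) :
    ∑ y : FiniteField.Extension F p n, G (minpoly F y)
      = ∑ P ∈ closedPoints F K with P.natDegree ∣ n, P.natDegree • G P := by
  have hint (y : FiniteField.Extension F p n) : IsIntegral F y := Algebra.IsIntegral.isIntegral y
  rw [← Finset.sum_fiberwise_of_maps_to (g := fun y => minpoly F y)
    (t := (closedPoints F K).filter fun P => P.natDegree ∣ n)]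
  · refine Finset.sum_congr rfl fun P hP => ?_
    rw [Finset.mem_filter, mem_closedPoints] at hP
    obtain ⟨⟨hmon, hirr, -⟩, hdvd⟩ := hP
    rw [Finset.sum_congr rfl fun y hy => by rw [(Finset.mem_filter.1 hy).2], Finset.sum_const]
    congr 1
    -- An irreducible polynomial whose degree divides `n` divides `X ^ (q ^ n) - X`. It therefore
    -- splits in the extension, and being separable it has exactly `P.natDegree` points above it.
    have hsplit : (P.map (algebraMap F (FiniteField.Extension F p n))).Splits := by
      refine Splits.of_dvd
        (IsSplittingField.splits (FiniteField.Extension F p n) (X ^ Nat.card F ^ n - X)) ?_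
        (map_dvd (mapRingHom (algebraMap _ _)) (hirr.natDegree_dvd_iff_dvd_X_pow_card_pow_sub_X.1 hdvd))
      exact map_ne_zero (FiniteField.X_pow_card_pow_sub_X_ne_zero _ (NeZero.ne n)
        Finite.one_lt_card)
    rw [← card_rootSet_eq_natDegree (PerfectField.separable_of_irreducible hirr) hsplit,
      ← Set.toFinset_card]
    congr 1
    ext y
    simp only [Finset.mem_filter, Finset.mem_univ, true_and, Set.mem_toFinset, mem_rootSet]
    constructor
    · rintro rfl
      exact ⟨hirr.ne_zero, minpoly.aeval F y⟩
    · rintro ⟨-, h⟩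
      exact (minpoly.eq_of_irreducible_of_monic hirr h hmon).symm
  · intro y _
    rw [Finset.mem_filter, mem_closedPoints]
    have h := natDegree_minpoly_dvd n y
    exact ⟨⟨minpoly.monic (hint y), minpoly.irreducible (hint y),
      (Nat.le_of_dvd (NeZero.pos n) h).trans hn⟩, h⟩

include p in
theorem sum_natDegree_closedPoints {n K : ℕ} (h0 : n ≠ 0) (hn : n ≤ K) :
    ∑ P ∈ closedPoints F K with P.natDegree ∣ n, P.natDegree = Nat.card F ^ n := by
  classical
  have := NeZero.mk h0
  let := Fintype.ofFinite (FiniteField.Extension F p n)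
  have h := sum_minpoly (F := F) (p := p) n hn (fun _ => 1)
  simp only [smul_eq_mul, mul_one, Finset.sum_const, Finset.card_univ] at h
  rw [← FiniteField.natCard_extension F p n, Nat.card_eq_fintype_card, h]

end ClosedPoints

/-! ### Equidistribution of the local traces over the family -/

/-- Every translation of `B` lifts to a permutation of `Ω`, so the law of `g` is translation
invariant, hence uniform. The proof averages over all the translations. -/
theorem expect_comp_eq_of_translation {Ω B : Type*} [Fintype Ω] [Nonempty Ω] [AddGroup B]
    [Fintype B] (g : Ω → B) (h : ∀ b, ∃ e : Ω ≃ Ω, ∀ ω, g (e ω) = g ω + b) (G : B → ℝ) :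
    𝔼 ω, G (g ω) = 𝔼 b, G b := by
  have h1 (b : B) : 𝔼 ω, G (g ω) = 𝔼 ω, G (g ω + b) := by
    obtain ⟨e, he⟩ := h b
    exact (Fintype.expect_equiv e _ _ fun ω => by rw [he]).symm
  calc 𝔼 ω, G (g ω) = 𝔼 _b : B, 𝔼 ω, G (g ω) := (Fintype.expect_const _).symm
    _ = 𝔼 b : B, 𝔼 ω, G (g ω + b) := Finset.expect_congr rfl fun b _ => h1 b
    _ = 𝔼 ω, 𝔼 b : B, G (g ω + b) := Finset.expect_comm _ _ _
    _ = 𝔼 _ω : Ω, 𝔼 b : B, G b := by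
      refine Finset.expect_congr rfl fun ω _ => ?_
      exact Fintype.expect_equiv (Equiv.addLeft (g ω)) _ _ fun b => rfl
    _ = _ := Fintype.expect_const _

section Family

variable {F : Type*} [Field F] [Finite F] {p : ℕ} [Fact p.Prime] [CharP F p]

/-- Every monomial has the same local traces as one whose exponent is `0` or prime to `p`. -/
theorem exists_monomial_localTrace_eq (n : ℕ) : ∀ a : F, ∃ m ≤ n, ∃ b : F, (m = 0 ∨ ¬ p ∣ m) ∧
    ∀ P : F[X], Irreducible P → localTrace p P (monomial m b) = localTrace p P (monomial n a) := by
  induction n using Nat.strong_induction_on with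
  | _ n ih =>
    intro a
    by_cases h : n = 0 ∨ ¬ p ∣ n
    · exact ⟨n, le_rfl, a, h, fun _ _ => rfl⟩
    · push Not at h
      obtain ⟨h0, k, rfl⟩ := h
      have hp : 1 < p := (Fact.out : p.Prime).one_lt
      have hk : k ≠ 0 := by rintro rfl; simp at h0
      have hlt : k < p * k := lt_mul_of_one_lt_left (Nat.pos_of_ne_zero hk) hp
      -- Write `a = c ^ p`: then `a X ^ (pk)` is the `p`-th power of `c X ^ k` and has the same
      -- local traces, so one descends to the exponent `k`.
      obtain ⟨c, rfl⟩ := (PerfectRing.bijective_frobenius (R := F) (p := p)).2 a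
      obtain ⟨m, hm, b, hb, hP⟩ := ih k hlt c
      refine ⟨m, hm.trans hlt.le, b, hb, fun P hirr => ?_⟩
      rw [hP P hirr, ← localTrace_pow hirr, monomial_pow, mul_comm]

/-- Each monomial is replaced separately. Exponents never increase, so the degree bound survives;
exponent `0` is harmless, as the constant term is unrestricted. -/
theorem exists_localTrace_eq {d : ℕ} (g : F[X]) (hg : g.degree < d) :
    ∃ v : F[X], v.degree < d ∧ (∀ k, 1 ≤ k → v.coeff (p * k) = 0) ∧
      ∀ P : F[X], Irreducible P → localTrace p P v = localTrace p P g := by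
  choose m hm b hb hP using fun n => exists_monomial_localTrace_eq (F := F) (p := p) n (g.coeff n)
  refine ⟨∑ n ∈ Finset.range d, monomial (m n) (b n), ?_, fun k hk => ?_, fun P hirr => ?_⟩
  · rw [← mem_degreeLT]
    refine Submodule.sum_mem _ fun n hn => ?_
    rw [mem_degreeLT]
    refine (degree_monomial_le _ _).trans_lt ?_
    exact_mod_cast (hm n).trans_lt (Finset.mem_range.1 hn)
  · rw [finsetSum_coeff]
    refine Finset.sum_eq_zero fun n _ => ?_
    rw [coeff_monomial, if_neg]
    intro h
    have hp : 0 < p := (Fact.out : p.Prime).pos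
    rcases hb n with h0 | h0
    · rw [h0] at h
      have := Nat.mul_pos hp hk
      omega
    · exact h0 ⟨k, h⟩
  · have hsum : g = ∑ n ∈ Finset.range d, monomial n (g.coeff n) := by
      rcases eq_or_ne g 0 with rfl | h0
      · simp
      · exact as_sum_range' g d ((natDegree_lt_iff_degree_lt h0).2 hg)
    conv_rhs => rw [hsum]
    rw [map_sum, map_sum]
    exact Finset.sum_congr rfl fun n _ => hP n P hirr

/-- The local traces at distinct closed points of total degree at most `d` can be prescribed. -/
theorem exists_prescribed_localTrace {d : ℕ} (A : Finset F[X]) (hA : ∀ P ∈ A, P.Monic ∧ Irreducible P)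
    (hd : ∑ P ∈ A, P.natDegree ≤ d) (b : A → ZMod p) :
    ∃ v : F[X], v.degree < d ∧ (∀ k, 1 ≤ k → v.coeff (p * k) = 0) ∧
      ∀ P : A, localTrace p P.1 v = b P := by
  choose u hu using fun P : A => localTrace_surjective (p := p) (hA P.1 P.2).2 (b P)
  have hcop : Pairwise (Function.onFun IsCoprime fun P : A => Ideal.span {P.1}) := by
    intro P Q hPQ
    rw [Function.onFun, Ideal.isCoprime_span_singleton_iff]
    refine (hA P.1 P.2).2.isCoprime_or_dvd Q.1 |>.resolve_right fun h => hPQ ?_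
    have h' := (hA P.1 P.2).2.associated_of_dvd (hA Q.1 Q.2).2 h
    exact Subtype.ext (eq_of_monic_of_associated (hA P.1 P.2).1 (hA Q.1 Q.2).1 h')
  obtain ⟨g, hg⟩ := Ideal.exists_forall_sub_mem_ideal hcop u
  have hmon : (∏ P ∈ A, P).Monic := monic_prod_of_monic _ _ fun P hP => (hA P hP).1
  -- Reducing the solution of the congruences modulo the product of the points brings its degree
  -- below their total degree, hence below `d`.
  obtain ⟨v, hv1, hv2, hv3⟩ := exists_localTrace_eq (p := p) (d := d) (g %ₘ ∏ P ∈ A, P) (by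
    refine (degree_modByMonic_lt g hmon).trans_le ?_
    rw [degree_eq_natDegree hmon.ne_zero, natDegree_prod_of_monic _ _ fun P hP => (hA P hP).1]
    exact_mod_cast hd)
  refine ⟨v, hv1, hv2, fun P => ?_⟩
  rw [hv3 P.1 (hA P.1 P.2).2, ← hu P]
  refine localTrace_eq_of_dvd_sub ?_
  have h1 := Ideal.mem_span_singleton.1 (hg P)
  have h2 : P.1 ∣ (∏ P ∈ A, P) * (g /ₘ ∏ P ∈ A, P) :=
    (Finset.dvd_prod_of_mem _ P.2).mul_right _
  have h3 : g %ₘ (∏ P ∈ A, P) - u P = (g - u P) - (∏ P ∈ A, P) * (g /ₘ ∏ P ∈ A, P) := by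
    conv_rhs => lhs; rw [← modByMonic_add_div g (∏ P ∈ A, P)]
    ring
  rw [h3]
  exact dvd_sub h1 h2

/-- The translation of the family by a polynomial of smaller degree without the excluded terms. -/
noncomputable def translate {d : ℕ} (v : F[X]) (hv : v.degree < d)
    (hv' : ∀ k, 1 ≤ k → v.coeff (p * k) = 0) : Family F p d ≃ Family F p d where
  toFun f := ⟨f.1 + v, by rw [degree_add_eq_left_of_degree_lt (by rwa [f.2.1])]; exact f.2.1,
    fun k h1 h2 => by rw [coeff_add, f.2.2 k h1 h2, hv' k h1, add_zero]⟩
  invFun f := ⟨f.1 - v, by rw [degree_sub_eq_left_of_degree_lt (by rwa [f.2.1])]; exact f.2.1,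
    fun k h1 h2 => by rw [coeff_sub, f.2.2 k h1 h2, hv' k h1, sub_zero]⟩
  left_inv f := Subtype.ext (by simp)
  right_inv f := Subtype.ext (by simp)

/-- Only the distinct points among the `κ j` matter, and their total degree is at most `r * K ≤ d`.
On both sides their values are uniform on `A → ZMod p`, so each expectation equals the same average
of `G`. -/
theorem expect_localTrace [∀ d, Fintype (Family F p d)] (d : {d : ℕ // ¬ p ∣ d}) {K r : ℕ}
    (hr : r * K ≤ d.1) (z : ZMod p → ℝ) [DecidableEq (closedPoints F K)]
    (κ : Fin r → closedPoints F K) :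
    𝔼 f : Family F p d.1, ∏ j, z (localTrace p (κ j).1 f.1)
      = 𝔼 ω : closedPoints F K → ZMod p, ∏ j, z (ω (κ j)) := by
  classical
  set A : Finset F[X] := Finset.univ.image fun j => (κ j).1 with hA
  have hAmem : ∀ P ∈ A, P ∈ closedPoints F K := by
    intro P hP
    obtain ⟨j, -, rfl⟩ := Finset.mem_image.1 hP
    exact (κ j).2
  have hdeg : ∑ P ∈ A, P.natDegree ≤ d.1 := by
    refine (Finset.sum_le_card_nsmul A _ K fun P hP => (mem_closedPoints.1 (hAmem P hP)).2.2).trans ?_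
    refine le_trans ?_ hr
    rw [smul_eq_mul]
    refine Nat.mul_le_mul_right K (Finset.card_image_le.trans ?_)
    simp
  let ι : Fin r → A := fun j => ⟨(κ j).1, Finset.mem_image_of_mem _ (Finset.mem_univ j)⟩
  let G : (A → ZMod p) → ℝ := fun b => ∏ j, z (b (ι j))
  have h1 := expect_comp_eq_of_translation
    (fun (f : Family F p d.1) (P : A) => localTrace p P.1 f.1) (fun b => by
      obtain ⟨v, hv1, hv2, hv3⟩ := exists_prescribed_localTrace A
        (fun P hP => ⟨(mem_closedPoints.1 (hAmem P hP)).1, (mem_closedPoints.1 (hAmem P hP)).2.1⟩)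
        hdeg b
      refine ⟨translate v hv1 hv2, fun f => funext fun P => ?_⟩
      simp [translate, hv3]) G
  have h2 := expect_comp_eq_of_translation
    (fun (ω : closedPoints F K → ZMod p) (P : A) => ω ⟨P.1, hAmem P.1 P.2⟩) (fun b => by
      refine ⟨Equiv.addRight fun P => if h : P.1 ∈ A then b ⟨P.1, h⟩ else 0, fun ω =>
        funext fun P => ?_⟩
      simp) G
  exact h1.trans h2.symm

end Family

/-! ### The statistic as a linear statistic of local traces -/

section Statistic

/-- The sum of the nontrivial characters of `ZMod p`. -/
def zeroStat (p : ℕ) (t : ZMod p) : ℝ := if t = 0 then (p : ℝ) - 1 else -1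

variable {p : ℕ} [Fact p.Prime]

/-- Separates the deterministic part of the statistic (`p ∣ n`) from the random one, in which the
multiplicity disappears. -/
theorem zeroStat_nsmul (n : ℕ) (t : ZMod p) :
    zeroStat p (n • t) = if p ∣ n then (p : ℝ) - 1 else zeroStat p t := by
  have h : n • t = 0 ↔ p ∣ n ∨ t = 0 := by
    rw [nsmul_eq_mul, mul_eq_zero, ZMod.natCast_eq_zero_iff]
  unfold zeroStat
  simp only [h]
  split_ifs <;> simp_all

theorem expect_zeroStat : 𝔼 t, zeroStat p t = 0 := by
  have hp : (p : ℝ) ≠ 0 := by exact_mod_cast (Fact.out : p.Prime).ne_zero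
  have h (t : ZMod p) : zeroStat p t = (if t = 0 then (p : ℝ) else 0) - 1 := by
    unfold zeroStat; split_ifs <;> ring
  simp_rw [h]
  rw [Finset.expect_sub_distrib, Fintype.expect_const, Fintype.expect_eq_sum_div_card,
    Finset.sum_ite_eq']
  simp [ZMod.card, hp]

theorem expect_zeroStat_sq : 𝔼 t, zeroStat p t ^ 2 = (p : ℝ) - 1 := by
  have hp : (p : ℝ) ≠ 0 := by exact_mod_cast (Fact.out : p.Prime).ne_zero
  have h (t : ZMod p) : zeroStat p t ^ 2 = (if t = 0 then (p : ℝ) * (p - 2) else 0) + 1 := by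
    unfold zeroStat; split_ifs <;> ring
  simp_rw [h]
  rw [Finset.expect_add_distrib, Fintype.expect_const, Fintype.expect_eq_sum_div_card,
    Finset.sum_ite_eq']
  simp only [Finset.mem_univ, if_true, ZMod.card]
  field_simp
  ring

theorem abs_zeroStat_le (t : ZMod p) : |zeroStat p t| ≤ p := by
  have hp : (1 : ℝ) ≤ p := by exact_mod_cast (Fact.out : p.Prime).one_lt.le
  unfold zeroStat
  split_ifs
  · rw [abs_of_nonneg] <;> linarith
  · simpa using hp

theorem sum_pow_addChar {ψ : AddChar (ZMod p) ℂ} (hψ : ψ ≠ 1) (t : ZMod p) :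
    ∑ m ∈ Finset.Icc 1 (p - 1), (ψ ^ m) t = (zeroStat p t : ℂ) := by
  have hp := (Fact.out : p.Prime)
  have hIcc : Finset.Icc 1 (p - 1) = Finset.Ico 1 p := by
    ext m; simp only [Finset.mem_Icc, Finset.mem_Ico]; have := hp.pos; omega
  have hsplit : ∑ m ∈ Finset.range p, (ψ t) ^ m = 1 + ∑ m ∈ Finset.Ico 1 p, (ψ t) ^ m := by
    rw [Finset.range_eq_Ico, Finset.sum_eq_sum_Ico_succ_bot hp.pos, pow_zero]
  simp only [AddChar.pow_apply, hIcc]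
  rw [← sub_eq_iff_eq_add'.2 hsplit]
  unfold zeroStat
  split_ifs with h
  · simp [h]
  · have h1 : ψ t ≠ 1 := by
      -- Any nonzero `t` generates `ZMod p`, so `ψ t = 1` would make `ψ` trivial.
      intro h1
      refine hψ (AddChar.ext _ _ fun s => ?_)
      have h2 : s = (s / t).val • t := by
        rw [nsmul_eq_mul, ZMod.natCast_zmod_val, div_mul_cancel₀ _ h]
      rw [h2, AddChar.map_nsmul_eq_pow, h1, one_pow, AddChar.one_apply]
    have h3 : ψ t ^ p = 1 := by
      rw [← AddChar.map_nsmul_eq_pow, nsmul_eq_mul, CharP.cast_eq_zero, zero_mul,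
        AddChar.map_zero_eq_one]
    have h4 := mul_geom_sum (ψ t) p
    rw [h3, sub_self, mul_eq_zero, or_iff_right (sub_ne_zero.2 h1)] at h4
    rw [h4]
    simp

variable {F : Type*} [Field F] [Finite F] [CharP F p]

open Classical in
theorem sum_charSum_pow {ψ : AddChar (ZMod p) ℂ} (hψ : ψ ≠ 1) (n : ℕ) [NeZero n] {K : ℕ}
    (hn : n ≤ K) (f : F[X]) :
    ∑ m ∈ Finset.Icc 1 (p - 1), charSum n f (ψ ^ m)
      = ((∑ P ∈ closedPoints F K with P.natDegree ∣ n, P.natDegree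
          * zeroStat p ((n / P.natDegree) • localTrace p P f) : ℝ) : ℂ) := by
  let := Fintype.ofFinite (FiniteField.Extension F p n)
  have h : ∑ m ∈ Finset.Icc 1 (p - 1), charSum n f (ψ ^ m)
      = ((∑ x : FiniteField.Extension F p n, zeroStat p
          (Algebra.trace (ZMod p) (FiniteField.Extension F p n) (aeval x f)) : ℝ) : ℂ) := by
    unfold charSum
    rw [Finset.sum_comm]
    push_cast
    exact Finset.sum_congr rfl fun x _ => sum_pow_addChar hψ _
  rw [h]
  congr 1
  simp only [trace_aeval]
  rw [sum_minpoly (F := F) (p := p) n hn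
    (fun P => zeroStat p ((n / P.natDegree) • localTrace p P f))]
  simp only [nsmul_eq_mul]

theorem sum_range_succ_eq_sum_Icc {M : Type*} [AddCommMonoid M] (K : ℕ) (g : ℕ → M) :
    ∑ j ∈ Finset.range K, g (j + 1) = ∑ k ∈ Finset.Icc 1 K, g k := by
  rw [Finset.range_eq_Ico, Finset.sum_Ico_add' g 0 K 1]
  rfl

open Classical in
theorem curveSum_eq {ψ : AddChar (ZMod p) ℂ} (hψ : ψ ≠ 1) {h : ℝ → ℝ} {K : ℕ} {c : ℕ → ℝ}
    (hc : ∀ k ∈ Finset.Icc 1 K, fourierCoefficient h k = c k) (f : F[X]) :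
    (curveSum ψ h K f).re = ∑ k ∈ Finset.Icc 1 K, 2 * c k * (√(Nat.card F : ℝ))⁻¹ ^ k
      * ∑ P ∈ closedPoints F K with P.natDegree ∣ k, P.natDegree
          * zeroStat p ((k / P.natDegree) • localTrace p P f) := by
  rw [← sum_range_succ_eq_sum_Icc]
  have hψ' : ψ⁻¹ ≠ 1 := by simpa using hψ
  have key : curveSum ψ h K f = ((∑ j ∈ Finset.range K,
      2 * c (j + 1) * (√(Nat.card F : ℝ))⁻¹ ^ (j + 1)
      * ∑ P ∈ closedPoints F K with P.natDegree ∣ j + 1, P.natDegree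
          * zeroStat p (((j + 1) / P.natDegree) • localTrace p P f) : ℝ) : ℂ) := by
    unfold curveSum smoothedSum
    rw [Finset.sum_comm, Complex.ofReal_sum]
    refine Finset.sum_congr rfl fun j hj => ?_
    have hjK : j + 1 ≤ K := Finset.mem_range.1 hj
    have hc1 : fourierCoefficient h (j + 1 : ℕ) = c (j + 1) :=
      hc (j + 1) (Finset.mem_Icc.2 ⟨Nat.le_add_left 1 j, hjK⟩)
    -- The coefficients at `k` and `-k` are conjugate and here real, hence equal. Since `ψ⁻¹` is
    -- also nontrivial, both halves of the sum contribute equally, whence the factor `2`.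
    have hc2 : fourierCoefficient h (-(j + 1 : ℕ)) = c (j + 1) := by
      rw [← conj_fourierCoefficient, hc1, Complex.conj_ofReal]
    have hpow : (Nat.card F : ℝ) ^ (((j + 1 : ℕ) : ℝ) / 2) = √(Nat.card F : ℝ) ^ (j + 1) := by
      rw [Real.sqrt_eq_rpow, ← Real.rpow_natCast, ← Real.rpow_mul (Nat.cast_nonneg _)]
      congr 1
      ring
    rw [← Finset.sum_div, Finset.sum_add_distrib, ← Finset.mul_sum, ← Finset.mul_sum, hc1, hc2,
      hpow]
    simp only [← inv_pow]
    rw [sum_charSum_pow hψ (j + 1) hjK, sum_charSum_pow hψ' (j + 1) hjK, Complex.ofReal_mul]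
    push_cast
    rw [div_eq_mul_inv, inv_pow]
    ring
  rw [key, Complex.ofReal_re]

open Classical in
/-- The coefficient of a closed point of degree `m` in the statistic. -/
noncomputable def pointCoeff (w : ℝ) (c : ℕ → ℝ) (p K m : ℕ) : ℝ :=
  ∑ k ∈ Finset.Icc 1 K with m ∣ k ∧ ¬ p ∣ k / m, m * (2 * c k * w ^ k)

open Classical in
/-- The deterministic part of the statistic. -/
noncomputable def drift (F : Type*) [Field F] [Finite F] (w : ℝ) (c : ℕ → ℝ) (p K : ℕ) : ℝ :=
  ∑ k ∈ Finset.Icc 1 K, 2 * c k * w ^ k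
    * (((p : ℝ) - 1) * ∑ P ∈ closedPoints F K with P.natDegree ∣ k ∧ p ∣ k / P.natDegree,
        (P.natDegree : ℝ))

theorem curveSum_eq_linear {ψ : AddChar (ZMod p) ℂ} (hψ : ψ ≠ 1) {h : ℝ → ℝ} {K : ℕ} {c : ℕ → ℝ}
    (hc : ∀ k ∈ Finset.Icc 1 K, fourierCoefficient h k = c k) (f : F[X]) :
    (curveSum ψ h K f).re
      = ∑ P : closedPoints F K, pointCoeff (√(Nat.card F : ℝ))⁻¹ c p K P.1.natDegree
          * zeroStat p (localTrace p P.1 f) + drift F (√(Nat.card F : ℝ))⁻¹ c p K := by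
  classical
  rw [curveSum_eq hψ hc, Finset.sum_coe_sort (closedPoints F K) fun P =>
    pointCoeff (√(Nat.card F : ℝ))⁻¹ c p K P.natDegree * zeroStat p (localTrace p P f)]
  unfold pointCoeff drift
  simp only [Finset.sum_mul, Finset.sum_filter]
  rw [Finset.sum_comm, ← Finset.sum_add_distrib]
  refine Finset.sum_congr rfl fun k _ => ?_
  rw [Finset.mul_sum, Finset.mul_sum, Finset.mul_sum, ← Finset.sum_add_distrib]
  refine Finset.sum_congr rfl fun P _ => ?_
  rw [zeroStat_nsmul]
  by_cases h1 : P.natDegree ∣ k <;> by_cases h2 : p ∣ k / P.natDegree <;>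
    simp only [h1, h2, if_true, if_false, true_and, false_and, and_self, not_true, not_false_eq_true] <;>
    ring

end Statistic

/-! ### Estimates for the coefficients -/

section Estimates

theorem sum_Icc_pow_le {w : ℝ} (h0 : 0 ≤ w) (h1 : w < 1) (a K : ℕ) :
    ∑ k ∈ Finset.Icc a K, w ^ k ≤ w ^ a / (1 - w) := by
  have h : Finset.Icc a K = Finset.Ico a (K + 1) := rfl
  rw [h]
  exact geom_sum_Ico_le_of_lt_one h0 h1

variable (F : Type*) [Field F] [Finite F]

/-- The number of closed points of degree `m`, for `m ≤ K`. -/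
noncomputable def pointCount (K m : ℕ) : ℕ :=
  ((closedPoints F K).filter fun P => P.natDegree = m).card

theorem sum_closedPoints_eq {M : Type*} [AddCommMonoid M] (K : ℕ) (g : ℕ → M) :
    ∑ P ∈ closedPoints F K, g P.natDegree = ∑ m ∈ Finset.Icc 1 K, pointCount F K m • g m := by
  rw [← Finset.sum_fiberwise_of_maps_to (g := fun P => P.natDegree) (t := Finset.Icc 1 K)]
  · refine Finset.sum_congr rfl fun m _ => ?_
    rw [Finset.sum_congr rfl fun P hP => by rw [(Finset.mem_filter.1 hP).2], Finset.sum_const]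
    rfl
  · intro P hP
    rw [mem_closedPoints] at hP
    exact Finset.mem_Icc.2 ⟨hP.2.1.natDegree_pos, hP.2.2⟩

variable {p : ℕ} [Fact p.Prime] [CharP F p]

include p

open Classical in
theorem sum_divisors_pointCount {K m : ℕ} (h0 : m ≠ 0) (hm : m ≤ K) :
    ∑ j ∈ Finset.Icc 1 K with j ∣ m, pointCount F K j * j = Nat.card F ^ m := by
  rw [← sum_natDegree_closedPoints (p := p) h0 hm, Finset.sum_filter, Finset.sum_filter,
    sum_closedPoints_eq F K fun j => if j ∣ m then j else 0]
  refine Finset.sum_congr rfl fun j _ => ?_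
  split_ifs <;> simp

theorem pointCount_mul_le {K m : ℕ} (h0 : m ≠ 0) (hm : m ≤ K) :
    pointCount F K m * m ≤ Nat.card F ^ m := by
  classical
  rw [← sum_divisors_pointCount (p := p) F h0 hm]
  exact Finset.single_le_sum (f := fun j => pointCount F K j * j) (fun _ _ => Nat.zero_le _)
    (Finset.mem_filter.2 ⟨Finset.mem_Icc.2 ⟨Nat.one_le_iff_ne_zero.2 h0, hm⟩, dvd_rfl⟩)

/-- Proper divisors of `m` are at most `m / 2`, so what they contribute to the count of `q ^ m`
points is at most a geometric sum. -/
theorem le_pointCount_mul {K m : ℕ} (h0 : m ≠ 0) (hm : m ≤ K) :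
    Nat.card F ^ m ≤ pointCount F K m * m + 2 * Nat.card F ^ (m / 2) := by
  classical
  have hq : 2 ≤ Nat.card F := Finite.one_lt_card
  have hgeom (n : ℕ) : ∑ j ∈ Finset.Icc 1 n, Nat.card F ^ j ≤ 2 * Nat.card F ^ n := by
    induction n with
    | zero => simp
    | succ n ih =>
      rw [Finset.sum_Icc_succ_top (by omega), pow_succ]
      nlinarith [Nat.pos_of_ne_zero (pow_ne_zero n (by omega : Nat.card F ≠ 0))]
  have hmem : m ∈ (Finset.Icc 1 K).filter fun j => j ∣ m := Finset.mem_filter.2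
    ⟨Finset.mem_Icc.2 ⟨Nat.one_le_iff_ne_zero.2 h0, hm⟩, dvd_rfl⟩
  rw [← sum_divisors_pointCount (p := p) F h0 hm, ← Finset.add_sum_erase _ _ hmem]
  refine Nat.add_le_add_left ?_ _
  refine le_trans ?_ (hgeom (m / 2))
  refine (Finset.sum_le_sum_of_subset (t := Finset.Icc 1 (m / 2)) fun j hj => ?_).trans
    (Finset.sum_le_sum fun j hj => ?_)
  · rw [Finset.mem_erase, Finset.mem_filter, Finset.mem_Icc] at hj
    obtain ⟨hne, ⟨h1, -⟩, k, rfl⟩ := hj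
    rw [Finset.mem_Icc]
    refine ⟨h1, ?_⟩
    rw [Nat.le_div_iff_mul_le two_pos]
    refine Nat.mul_le_mul_left j ?_
    rcases k with _ | _ | k
    · simp at h0
    · simp at hne
    · omega
  · rw [Finset.mem_Icc] at hj
    exact pointCount_mul_le (p := p) F (by omega) (by omega)

end Estimates

/-! ### Weights of the closed points, their sum of squares, and the drift -/

section CoefficientBounds

variable {w C : ℝ} {c : ℕ → ℝ} {K : ℕ}

/-- The main term is `k = m`, which survives as `p ∤ 1`. Every other multiple of `m` is at least `2
* m`, and there `m * |c k| ≤ k * |c k| ≤ C` leaves a geometric tail. -/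
theorem abs_pointCoeff_sub_le (hw0 : 0 ≤ w) (hw1 : w < 1) (hC : 0 ≤ C)
    (hc : ∀ k ∈ Finset.Icc 1 K, k * |c k| ≤ C) {p m : ℕ} (hp : 1 < p) (hm : m ∈ Finset.Icc 1 K) :
    |pointCoeff w c p K m - 2 * (m * c m) * w ^ m| ≤ 2 * C / (1 - w) * w ^ (2 * m) := by
  classical
  have hm1 := (Finset.mem_Icc.1 hm).1
  have hmem : m ∈ (Finset.Icc 1 K).filter fun k => m ∣ k ∧ ¬ p ∣ k / m := by
    refine Finset.mem_filter.2 ⟨hm, dvd_rfl, ?_⟩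
    rw [Nat.div_self hm1, Nat.dvd_one]
    exact hp.ne'
  have hsplit : pointCoeff w c p K m - 2 * (m * c m) * w ^ m
      = ∑ k ∈ ((Finset.Icc 1 K).filter fun k => m ∣ k ∧ ¬ p ∣ k / m).erase m,
        m * (2 * c k * w ^ k) := by
    unfold pointCoeff
    rw [← Finset.add_sum_erase _ _ hmem]
    ring
  have hsub : ((Finset.Icc 1 K).filter fun k => m ∣ k ∧ ¬ p ∣ k / m).erase m
      ⊆ Finset.Icc (2 * m) K := by
    intro k hk
    rw [Finset.mem_erase, Finset.mem_filter, Finset.mem_Icc] at hk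
    obtain ⟨hne, ⟨h1, h2⟩, ⟨j, rfl⟩, -⟩ := hk
    rw [Finset.mem_Icc]
    refine ⟨?_, h2⟩
    rcases j with _ | _ | j
    · simp at h1
    · simp at hne
    · rw [mul_comm]; exact Nat.mul_le_mul_left m (by omega)
  rw [hsplit]
  calc |∑ k ∈ ((Finset.Icc 1 K).filter fun k => m ∣ k ∧ ¬ p ∣ k / m).erase m,
        m * (2 * c k * w ^ k)|
      ≤ ∑ k ∈ ((Finset.Icc 1 K).filter fun k => m ∣ k ∧ ¬ p ∣ k / m).erase m,
        2 * C * w ^ k := by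
        refine (Finset.abs_sum_le_sum_abs _ _).trans (Finset.sum_le_sum fun k hk => ?_)
        have hk' := Finset.mem_Icc.1 (hsub hk)
        have h1 : (m : ℝ) * |c k| ≤ C := by
          refine le_trans ?_ (hc k (Finset.mem_Icc.2 ⟨by omega, hk'.2⟩))
          gcongr
          omega
        rw [abs_mul, abs_mul, abs_mul, Nat.abs_cast, abs_two, abs_of_nonneg (pow_nonneg hw0 k)]
        have := mul_le_mul_of_nonneg_right h1 (pow_nonneg hw0 k)
        nlinarith
    _ ≤ ∑ k ∈ Finset.Icc (2 * m) K, 2 * C * w ^ k :=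
        Finset.sum_le_sum_of_subset_of_nonneg hsub fun k _ _ => by positivity
    _ ≤ 2 * C * (w ^ (2 * m) / (1 - w)) := by
        rw [← Finset.mul_sum]
        exact mul_le_mul_of_nonneg_left (sum_Icc_pow_le hw0 hw1 _ _) (by positivity)
    _ = _ := by ring

theorem abs_pointCoeff_le (hw0 : 0 ≤ w) (hw1 : w < 1) (hC : 0 ≤ C)
    (hc : ∀ k ∈ Finset.Icc 1 K, k * |c k| ≤ C) {p m : ℕ} (hp : 1 < p) (hm : m ∈ Finset.Icc 1 K) :
    |pointCoeff w c p K m| ≤ 2 * C / (1 - w) + 2 * C := by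
  have h1 := abs_pointCoeff_sub_le hw0 hw1 hC hc hp hm
  have h2 : |2 * (m * c m) * w ^ m| ≤ 2 * C := by
    rw [abs_mul, abs_mul, abs_mul, Nat.abs_cast, abs_two, abs_of_nonneg (pow_nonneg hw0 m)]
    have h3 := hc m hm
    have h4 := pow_le_one₀ (n := m) hw0 hw1.le
    have h5 : 2 * (m * |c m|) * w ^ m ≤ 2 * C * 1 := by gcongr
    linarith
  have h3 : 2 * C / (1 - w) * w ^ (2 * m) ≤ 2 * C / (1 - w) :=
    mul_le_of_le_one_right (div_nonneg (by positivity) (by linarith))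
      (pow_le_one₀ hw0 hw1.le)
  calc |pointCoeff w c p K m|
      = |(pointCoeff w c p K m - 2 * (m * c m) * w ^ m) + 2 * (m * c m) * w ^ m| := by ring_nf
    _ ≤ _ := (abs_add_le _ _).trans (by linarith)

variable (F : Type*) [Field F] [Finite F] {p : ℕ} [Fact p.Prime] [CharP F p]

theorem one_lt_sqrt_card : 1 < √(Nat.card F : ℝ) := by
  rw [Real.lt_sqrt zero_le_one]
  have : 1 < Nat.card F := Finite.one_lt_card
  simpa using this

theorem inv_sqrt_card_pos : 0 < (√(Nat.card F : ℝ))⁻¹ :=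
  inv_pos.2 (zero_lt_one.trans (one_lt_sqrt_card F))

theorem inv_sqrt_card_lt_one : (√(Nat.card F : ℝ))⁻¹ < 1 :=
  inv_lt_one_of_one_lt₀ (one_lt_sqrt_card F)

theorem card_mul_inv_sqrt_sq (m : ℕ) :
    (Nat.card F : ℝ) ^ m * (√(Nat.card F : ℝ))⁻¹ ^ (2 * m) = 1 := by
  have h : (Nat.card F : ℝ) ≠ 0 := by exact_mod_cast Nat.card_pos.ne'
  rw [inv_pow, pow_mul, Real.sq_sqrt (Nat.cast_nonneg _), mul_inv_cancel₀ (pow_ne_zero m h)]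

include p

/-- With `N ≈ q ^ m / m` points of weight about `2 m c_m q ^ (-m/2)`, the product is about `4 m c_m
^ 2`. The error decays like `q ^ (-m/2)`, so it sums to `O(1)`. -/
theorem abs_variance_term_le (hC : 0 ≤ C) (hc : ∀ k ∈ Finset.Icc 1 K, k * |c k| ≤ C) {m : ℕ}
    (hm : m ∈ Finset.Icc 1 K) :
    |pointCount F K m * pointCoeff (√(Nat.card F : ℝ))⁻¹ c p K m ^ 2 - 4 * (m * c m ^ 2)|
      ≤ (2 * C / (1 - (√(Nat.card F : ℝ))⁻¹) * (4 * C + 2 * C / (1 - (√(Nat.card F : ℝ))⁻¹))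
          + 8 * C ^ 2) * (√(Nat.card F : ℝ))⁻¹ ^ m := by
  obtain ⟨hm1, hmK⟩ := Finset.mem_Icc.1 hm
  have hp : 1 < p := (Fact.out : p.Prime).one_lt
  have hw0 := (inv_sqrt_card_pos F)
  have hw1 := inv_sqrt_card_lt_one F
  have hqw := card_mul_inv_sqrt_sq F m
  have h1 := abs_pointCoeff_sub_le hw0.le hw1 hC hc hp hm
  have hN1 : (pointCount F K m : ℝ) * m ≤ (Nat.card F : ℝ) ^ m := by
    exact_mod_cast pointCount_mul_le (p := p) F (by omega) hmK
  have hN2 : (Nat.card F : ℝ) ^ m ≤ pointCount F K m * m + 2 * (Nat.card F : ℝ) ^ (m / 2) := by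
    exact_mod_cast le_pointCount_mul (p := p) F (by omega) hmK
  have hN3 : (Nat.card F : ℝ) ^ (m / 2) * (√(Nat.card F : ℝ))⁻¹ ^ m ≤ 1 := by
    rw [← card_mul_inv_sqrt_sq F (m / 2)]
    exact mul_le_mul_of_nonneg_left (pow_le_pow_of_le_one hw0.le hw1.le (by omega)) (by positivity)
  set w := (√(Nat.card F : ℝ))⁻¹ with hw
  set N : ℝ := (pointCount F K m : ℝ) with hN
  set A := pointCoeff w c p K m with hA
  set C' := 2 * C / (1 - w) with hC'
  set Q : ℝ := (Nat.card F : ℝ) ^ m with hQ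
  set Q' : ℝ := (Nat.card F : ℝ) ^ (m / 2) with hQ'
  have hC'0 : 0 ≤ C' := div_nonneg (by positivity) (by linarith)
  have hm1' : (1 : ℝ) ≤ m := by exact_mod_cast hm1
  have hN0 : 0 ≤ N := Nat.cast_nonneg _
  have hNQ : N ≤ Q := (le_mul_of_one_le_right hN0 hm1').trans hN1
  have hwm : 0 ≤ w ^ m := pow_nonneg hw0.le m
  have hwm1 : w ^ m ≤ 1 := pow_le_one₀ hw0.le hw1.le
  have hw2 : w ^ (2 * m) = w ^ m * w ^ m := by rw [two_mul, pow_add]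
  rw [hw2] at hqw h1
  set u := w ^ m with hu
  have hmc : |(m : ℝ) * c m| ≤ C := by rw [abs_mul, Nat.abs_cast]; exact hc m hm
  set x := 2 * (m * c m) * u with hx
  have hxb : |x| ≤ 2 * C * u := by
    rw [hx, abs_mul, abs_mul, abs_two, abs_of_nonneg hwm]
    gcongr
  have hA2 : |A ^ 2 - x ^ 2| ≤ C' * (u * u) * ((4 * C + C') * u) := by
    have e1 : A ^ 2 - x ^ 2 = (A - x) * (2 * x + (A - x)) := by ring
    rw [e1, abs_mul]
    refine mul_le_mul h1 ?_ (abs_nonneg _) (by positivity)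
    refine (abs_add_le _ _).trans ?_
    rw [abs_mul, abs_two]
    have : C' * (u * u) ≤ C' * (u * 1) := by gcongr
    linarith
  -- First error: the weight `A` is replaced by its main term `x`.
  have hpart1 : |N * (A ^ 2 - x ^ 2)| ≤ C' * (4 * C + C') * u := by
    rw [abs_mul, abs_of_nonneg hN0]
    calc N * |A ^ 2 - x ^ 2| ≤ Q * (C' * (u * u) * ((4 * C + C') * u)) := by gcongr
      _ = (Q * (u * u)) * (C' * (4 * C + C') * u) := by ring
      _ = _ := by rw [hqw, one_mul]
  have hmc2 : m * c m ^ 2 ≤ C ^ 2 := by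
    calc m * c m ^ 2 ≤ m * (m * c m ^ 2) := le_mul_of_one_le_left (by positivity) hm1'
      _ = |m * c m| ^ 2 := by rw [sq_abs]; ring
      _ ≤ C ^ 2 := by gcongr
  -- Second error: `N * m` is replaced by `Q`, at a cost of at most `2 * Q'`.
  have hpart2 : |N * x ^ 2 - 4 * (m * c m ^ 2)| ≤ 8 * C ^ 2 * u := by
    have e1 : N * x ^ 2 - 4 * (m * c m ^ 2)
        = -(4 * (m * c m ^ 2) * ((Q - N * m) * (u * u))) := by
      rw [hx]
      linear_combination (4 * (m * c m ^ 2)) * hqw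
    have h2 : (Q - N * m) * (u * u) ≤ 2 * u := by
      calc (Q - N * m) * (u * u) ≤ (2 * Q') * (u * u) := by
            gcongr
            linarith
        _ = 2 * (Q' * u) * u := by ring
        _ ≤ 2 * 1 * u := by gcongr
        _ = 2 * u := by ring
    have h3 : 0 ≤ (Q - N * m) * (u * u) := mul_nonneg (by linarith) (by positivity)
    rw [e1, abs_neg, abs_of_nonneg (by positivity)]
    calc 4 * (m * c m ^ 2) * ((Q - N * m) * (u * u)) ≤ 4 * C ^ 2 * (2 * u) := by gcongr
      _ = _ := by ring
  calc |N * A ^ 2 - 4 * (m * c m ^ 2)|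
      = |N * (A ^ 2 - x ^ 2) + (N * x ^ 2 - 4 * (m * c m ^ 2))| := by ring_nf
    _ ≤ _ := (abs_add_le _ _).trans (by linarith)

theorem abs_sum_pointCoeff_sq_sub_le (hC : 0 ≤ C) (hc : ∀ k ∈ Finset.Icc 1 K, k * |c k| ≤ C) :
    |∑ P : closedPoints F K, pointCoeff (√(Nat.card F : ℝ))⁻¹ c p K P.1.natDegree ^ 2
        - 4 * ∑ m ∈ Finset.Icc 1 K, m * c m ^ 2|
      ≤ (2 * C / (1 - (√(Nat.card F : ℝ))⁻¹) * (4 * C + 2 * C / (1 - (√(Nat.card F : ℝ))⁻¹))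
          + 8 * C ^ 2) * (1 / (1 - (√(Nat.card F : ℝ))⁻¹)) := by
  have hw0 := inv_sqrt_card_pos F
  have hw1 := inv_sqrt_card_lt_one F
  rw [Finset.sum_coe_sort (closedPoints F K) fun P =>
      pointCoeff (√(Nat.card F : ℝ))⁻¹ c p K P.natDegree ^ 2,
    sum_closedPoints_eq F K fun m => pointCoeff (√(Nat.card F : ℝ))⁻¹ c p K m ^ 2,
    Finset.mul_sum, ← Finset.sum_sub_distrib]
  refine (Finset.abs_sum_le_sum_abs _ _).trans ?_
  simp only [nsmul_eq_mul]
  refine (Finset.sum_le_sum fun m hm => abs_variance_term_le (p := p) F hC hc hm).trans ?_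
  rw [← Finset.mul_sum]
  have h1w : 0 < 1 - (√(Nat.card F : ℝ))⁻¹ := by linarith
  refine mul_le_mul_of_nonneg_left ((sum_Icc_pow_le hw0.le hw1 1 K).trans ?_) (by positivity)
  gcongr
  rw [pow_one]
  exact hw1.le

open Classical in
-- The conditions force `p ∣ k` and `deg P ∣ k / p`, so the sum is at most `q ^ (k / p)`. The
-- hypothesis `3 ≤ p` puts this strictly below the square-root size `q ^ (k / 2)` of the
-- normalization.
theorem sum_drift_le {k : ℕ} (hk : k ∈ Finset.Icc 1 K) (hp3 : 3 ≤ p) :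
    ∑ P ∈ closedPoints F K with P.natDegree ∣ k ∧ p ∣ k / P.natDegree, (P.natDegree : ℝ)
      ≤ (Nat.card F : ℝ) ^ (k / 3) := by
  obtain ⟨hk1, hkK⟩ := Finset.mem_Icc.1 hk
  have hq : 1 ≤ Nat.card F := Nat.card_pos
  by_cases hpk : p ∣ k
  · obtain ⟨j, rfl⟩ := hpk
    have hp0 : 0 < p := by omega
    have hj : j ≠ 0 := by rintro rfl; simp at hk1
    have hjK : j ≤ K := (Nat.le_mul_of_pos_left j hp0).trans hkK
    have h1 : ∑ P ∈ closedPoints F K with P.natDegree ∣ p * j ∧ p ∣ p * j / P.natDegree,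
        P.natDegree ≤ Nat.card F ^ (p * j / 3) := by
      calc _ ≤ ∑ P ∈ closedPoints F K with P.natDegree ∣ j, P.natDegree := by
            refine Finset.sum_le_sum_of_subset fun P hP => ?_
            rw [Finset.mem_filter] at hP ⊢
            refine ⟨hP.1, ?_⟩
            obtain ⟨-, ⟨a, ha⟩, hdiv⟩ := hP
            have hd0 : 0 < P.natDegree := by
              rcases Nat.eq_zero_or_pos P.natDegree with h | h
              · rw [h, zero_mul] at ha; omega
              · exact h
            rw [ha, Nat.mul_div_cancel_left a hd0] at hdiv
            obtain ⟨b, rfl⟩ := hdiv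
            exact ⟨b, Nat.eq_of_mul_eq_mul_left hp0 (by rw [ha]; ring)⟩
        _ = Nat.card F ^ j := sum_natDegree_closedPoints (p := p) hj hjK
        _ ≤ _ := by
            refine Nat.pow_le_pow_right hq ?_
            rw [Nat.le_div_iff_mul_le (by norm_num), mul_comm]
            exact Nat.mul_le_mul_right j hp3
    exact_mod_cast h1
  · rw [Finset.filter_false_of_mem, Finset.sum_empty]
    · positivity
    · rintro P - ⟨h1, h2⟩
      exact hpk (h2.trans (Nat.div_dvd_of_dvd h1))

theorem abs_drift_le (hp3 : 3 ≤ p) (hc : ∀ k ∈ Finset.Icc 1 K, k * |c k| ≤ C) (hC : 0 ≤ C) :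
    |drift F (√(Nat.card F : ℝ))⁻¹ c p K|
      ≤ 2 * C * p * (1 / (1 - (√(Nat.card F : ℝ))⁻¹ ^ (1 / 3 : ℝ))) := by
  classical
  have hw0 := inv_sqrt_card_pos F
  have hw1 := inv_sqrt_card_lt_one F
  set w := (√(Nat.card F : ℝ))⁻¹ with hw
  set u := w ^ (1 / 3 : ℝ) with hu
  have hu0 : 0 < u := Real.rpow_pos_of_pos hw0 _
  have hu1 : u < 1 := Real.rpow_lt_one hw0.le hw1 (by norm_num)
  have huw : w = u ^ 3 := by
    rw [hu, ← Real.rpow_natCast, ← Real.rpow_mul hw0.le]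
    norm_num
  have hp1 : (1 : ℝ) ≤ p := by exact_mod_cast (by omega : 1 ≤ p)
  unfold drift
  calc _ ≤ ∑ k ∈ Finset.Icc 1 K, 2 * C * p * u ^ k := by
        refine (Finset.abs_sum_le_sum_abs _ _).trans (Finset.sum_le_sum fun k hk => ?_)
        have hk1 := (Finset.mem_Icc.1 hk).1
        have h1 := sum_drift_le (p := p) F hk hp3
        set S := ∑ P ∈ closedPoints F K with P.natDegree ∣ k ∧ p ∣ k / P.natDegree,
          (P.natDegree : ℝ) with hS
        have hS0 : 0 ≤ S := Finset.sum_nonneg fun P _ => Nat.cast_nonneg _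
        have hck : |c k| ≤ C := by
          refine le_trans ?_ (hc k hk)
          exact le_mul_of_one_le_left (abs_nonneg _) (by exact_mod_cast hk1)
        -- As `q = w ^ (-2)`, the left side is `w ^ (k - 2 * (k / 3))`, whose exponent is at least
        -- one third of `k` despite the rounding; this is why `u` is the cube root of `w`.
        have h2 : w ^ k * (Nat.card F : ℝ) ^ (k / 3) ≤ u ^ k := by
          have e1 : w ^ k = w ^ (k - 2 * (k / 3)) * w ^ (2 * (k / 3)) := by
            rw [← pow_add]; congr 1; omega
          rw [e1, mul_assoc, mul_comm (w ^ (2 * (k / 3))), card_mul_inv_sqrt_sq, mul_one, huw,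
            ← pow_mul]
          exact pow_le_pow_of_le_one hu0.le hu1.le (by omega)
        rw [abs_mul, abs_mul, abs_mul, abs_two, abs_of_nonneg (pow_nonneg hw0.le k),
          abs_of_nonneg (mul_nonneg (by linarith) hS0)]
        calc 2 * |c k| * w ^ k * (((p : ℝ) - 1) * S)
            ≤ 2 * C * w ^ k * ((p : ℝ) * (Nat.card F : ℝ) ^ (k / 3)) := by
              gcongr
              linarith
          _ = 2 * C * p * (w ^ k * (Nat.card F : ℝ) ^ (k / 3)) := by ring
          _ ≤ _ := by gcongr
    _ ≤ _ := by
        rw [← Finset.mul_sum]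
        have h1u : 0 < 1 - u := by linarith
        refine mul_le_mul_of_nonneg_left ((sum_Icc_pow_le hu0.le hu1 1 K).trans ?_) (by positivity)
        gcongr
        rw [pow_one]
        exact hu1.le

end CoefficientBounds

/-! ### Fourier coefficients of the Beurling–Selberg polynomials -/

section Fourier

theorem integral_e_intCast_mul (n : ℤ) :
    ∫ θ in (-(1 / 2 : ℝ))..(1 / 2), e (n * θ) = if n = 0 then 1 else 0 := by
  split_ifs with h
  · subst h
    simp [e]
    norm_num
  · have hc : (2 * Real.pi * Complex.I * n : ℂ) ≠ 0 := by
      simp [Real.pi_ne_zero, h]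
    have h1 : ∀ θ : ℝ, e (n * θ) = Complex.exp ((2 * Real.pi * Complex.I * n) * θ) := by
      intro θ
      unfold e
      congr 1
      push_cast
      ring
    simp_rw [h1]
    rw [integral_exp_mul_complex hc, div_eq_zero_iff, or_iff_left hc, sub_eq_zero,
      Complex.exp_eq_exp_iff_exists_int]
    refine ⟨n, ?_⟩
    push_cast
    ring

theorem e_add (x y : ℝ) : e (x + y) = e x * e y := by
  unfold e
  rw [← Complex.exp_add]
  push_cast
  ring_nf

theorem continuous_e : Continuous e := by
  unfold e
  fun_prop

theorem two_cos_eq_e (x : ℝ) : ((2 * Real.cos (2 * Real.pi * x) : ℝ) : ℂ) = e x + e (-x) := by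
  unfold e
  push_cast
  rw [Complex.two_cos]
  ring_nf

/-- The Fourier coefficients of a cosine polynomial. -/
theorem fourierCoefficient_cos_sum (a₀ : ℝ) (a : ℕ → ℝ) {K k : ℕ} (hk : k ∈ Finset.Icc 1 K) :
    fourierCoefficient
      (fun x => a₀ + ∑ j ∈ Finset.Icc 1 K, a j * (2 * Real.cos (2 * Real.pi * (j * x)))) k
      = a k := by
  have hk1 := (Finset.mem_Icc.1 hk).1
  have hcont (b : ℂ) (n : ℤ) : Continuous fun θ : ℝ => b * e (n * θ) :=
    continuous_const.mul (continuous_e.comp (by fun_prop))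
  have hpair (b : ℂ) (n n' : ℤ) : Continuous fun θ : ℝ => b * e (n * θ) + b * e (n' * θ) :=
    (hcont b n).add (hcont b n')
  have hint (b : ℂ) (n : ℤ) :
      IntervalIntegrable (fun θ : ℝ => b * e (n * θ)) volume (-(1 / 2)) (1 / 2) :=
    (hcont b n).intervalIntegrable _ _
  have h1 : ∀ θ : ℝ, ((a₀ + ∑ j ∈ Finset.Icc 1 K, a j * (2 * Real.cos (2 * Real.pi * (j * θ))) : ℝ) : ℂ)
      * e (-((k : ℤ) : ℝ) * θ)
      = a₀ * e (((-k : ℤ) : ℝ) * θ) + ∑ j ∈ Finset.Icc 1 K,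
        (a j * e (((j - k : ℤ) : ℝ) * θ) + a j * e (((-j - k : ℤ) : ℝ) * θ)) := by
    intro θ
    rw [Complex.ofReal_add, Complex.ofReal_sum, add_mul, Finset.sum_mul]
    congr 1
    · push_cast; rfl
    · refine Finset.sum_congr rfl fun j _ => ?_
      rw [Complex.ofReal_mul, two_cos_eq_e, mul_assoc, add_mul, mul_add, ← e_add, ← e_add]
      push_cast
      ring_nf
  unfold fourierCoefficient
  simp_rw [h1]
  rw [intervalIntegral.integral_add (hint _ _) ((continuous_finsetSum _ fun j _ =>
      hpair (a j) (j - k) (-j - k)).intervalIntegrable _ _),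
    intervalIntegral.integral_finsetSum fun j _ =>
      (hpair (a j) (j - k) (-j - k)).intervalIntegrable _ _]
  simp_rw [intervalIntegral.integral_add (hint _ _) (hint _ _),
    intervalIntegral.integral_const_mul, integral_e_intCast_mul]
  rw [if_neg (by omega), Finset.sum_eq_single k]
  · rw [if_pos (by omega), if_neg (by omega)]
    simp
  · intro j hj hjk
    have := (Finset.mem_Icc.1 hj).1
    rw [if_neg (by omega), if_neg (by omega)]
    simp
  · exact fun h => absurd hk h

/-! ### Explicit coefficients of the Vaaler and Beurling–Selberg polynomials -/

theorem sum_mul_pow_mul_sub_one (z : ℂ) (n : ℕ) :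
    (∑ j ∈ Finset.range n, (j : ℂ) * z ^ j) * (z - 1)
      = n * z ^ n - z * ∑ j ∈ Finset.range n, z ^ j := by
  induction n with
  | zero => simp
  | succ n ih =>
    rw [Finset.sum_range_succ, Finset.sum_range_succ, add_mul, ih]
    push_cast
    ring

/-- This is the discrete Fourier transform of the sawtooth at the `(K + 1)`-th root of unity `z`,
which is a cotangent; the sum is the real part after multiplication by a phase. -/
theorem sum_sawtooth_cos {K k : ℕ} (hk : k ∈ Finset.Icc 1 K) (x : ℝ) :
    ∑ j ∈ Finset.Icc 1 K, ((j : ℝ) / (K + 1) - 1 / 2)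
        * Real.cos (2 * Real.pi * k * (x - j / (K + 1)))
      = -(1 / 2) * (Real.cos (Real.pi * k / (K + 1)) / Real.sin (Real.pi * k / (K + 1)))
        * Real.sin (2 * Real.pi * k * x) := by
  obtain ⟨hk1, hkK⟩ := Finset.mem_Icc.1 hk
  have hN : (0 : ℝ) < K + 1 := by positivity
  have hNc : ((K : ℂ) + 1) ≠ 0 := by exact_mod_cast hN.ne'
  set t : ℝ := Real.pi * k / (K + 1) with ht
  have ht0 : 0 < t := by
    have : (0 : ℝ) < k := by exact_mod_cast hk1
    positivity
  have htpi : t < Real.pi := by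
    rw [ht, div_lt_iff₀ hN]
    have : (k : ℝ) < K + 1 := by exact_mod_cast Nat.lt_succ_of_le hkK
    exact mul_lt_mul_of_pos_left this Real.pi_pos
  have hsin : Real.sin t ≠ 0 := (Real.sin_pos_of_pos_of_lt_pi ht0 htpi).ne'
  set y : ℂ := Complex.exp (t * Complex.I) with hy
  set z : ℂ := Complex.exp (-(2 * t) * Complex.I) with hz
  have hzN : z ^ (K + 1) = 1 := by
    rw [hz, ← Complex.exp_nat_mul, Complex.exp_eq_one_iff]
    refine ⟨-k, ?_⟩
    rw [ht]
    push_cast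
    field_simp
  have hy0 : y ≠ 0 := Complex.exp_ne_zero _
  have hzy : z = y⁻¹ ^ 2 := by
    rw [hz, hy, ← Complex.exp_neg, ← Complex.exp_nat_mul]
    congr 1
    push_cast
    ring
  have hycos : y + y⁻¹ = 2 * Real.cos t := by
    rw [hy, ← Complex.exp_neg, Complex.ofReal_cos, Complex.two_cos, neg_mul]
  have hysin : y⁻¹ - y = -2 * Complex.I * Real.sin t := by
    have h := Complex.two_sin (t : ℂ)
    rw [hy, ← Complex.exp_neg, Complex.ofReal_sin]
    have : -2 * Complex.I * Complex.sin t = -Complex.I * (2 * Complex.sin t) := by ring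
    rw [this, h, neg_mul (t : ℂ)]
    have hI := Complex.I_mul_I
    linear_combination (Complex.exp (-(t * Complex.I)) - Complex.exp (t * Complex.I)) * hI
  have hsinc : (Real.sin t : ℂ) ≠ 0 := by exact_mod_cast hsin
  have hz1 : z - 1 = y⁻¹ * (-2 * Complex.I * Real.sin t) := by
    rw [← hysin, hzy]; field_simp
  have hzne : z - 1 ≠ 0 := by
    rw [hz1]
    exact mul_ne_zero (inv_ne_zero hy0)
      (mul_ne_zero (mul_ne_zero (by norm_num) Complex.I_ne_zero) hsinc)
  have hzp : z + 1 = y⁻¹ * (2 * Real.cos t) := by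
    rw [← hycos, hzy]; field_simp; ring
  have hgeom : ∑ j ∈ Finset.range (K + 1), z ^ j = 0 := by
    have h := geom_sum_mul z (K + 1)
    rw [hzN, sub_self] at h
    exact (mul_eq_zero.1 h).resolve_right hzne
  have hlin : ∑ j ∈ Finset.range (K + 1), (j : ℂ) * z ^ j = (K + 1) / (z - 1) := by
    rw [eq_div_iff hzne, sum_mul_pow_mul_sub_one, hgeom, hzN]
    push_cast
    ring
  have hsum : ∑ j ∈ Finset.Icc 1 K, ((j : ℂ) / (K + 1) - 1 / 2) * z ^ j
      = Complex.I / 2 * (Real.cos t / Real.sin t) := by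
    -- The full period includes `j = 0`, whose term `-1 / 2` is removed afterwards.
    have h1 : ∑ j ∈ Finset.range (K + 1), ((j : ℂ) / (K + 1) - 1 / 2) * z ^ j = 1 / (z - 1) := by
      have h2 : ∀ j : ℕ, ((j : ℂ) / (K + 1) - 1 / 2) * z ^ j
          = (1 / (K + 1)) * (j * z ^ j) - 1 / 2 * z ^ j := fun j => by ring
      simp_rw [h2]
      rw [Finset.sum_sub_distrib, ← Finset.mul_sum, ← Finset.mul_sum, hgeom, hlin]
      field_simp
      ring
    rw [Finset.range_eq_Ico, Finset.sum_eq_sum_Ico_succ_bot (Nat.succ_pos K)] at h1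
    have h3 : ∑ j ∈ Finset.Icc 1 K, ((j : ℂ) / (K + 1) - 1 / 2) * z ^ j
        = 1 / (z - 1) + 1 / 2 := by
      rw [← h1]
      have : Finset.Ico (0 + 1) (K + 1) = Finset.Icc 1 K := rfl
      rw [this]
      simp
    rw [h3]
    have h4 : 1 / (z - 1) + 1 / 2 = (z + 1) / (2 * (z - 1)) := by field_simp; ring
    rw [h4, hz1, hzp]
    have hI := Complex.I_sq
    field_simp
    linear_combination -(Real.cos t : ℂ) * hI
  have hterm : ∀ j : ℕ, ((j : ℝ) / (K + 1) - 1 / 2) * Real.cos (2 * Real.pi * k * (x - j / (K + 1)))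
      = (Complex.exp ((2 * Real.pi * k * x : ℝ) * Complex.I)
        * (((j : ℂ) / (K + 1) - 1 / 2) * z ^ j)).re := by
    intro j
    have h1 : Complex.exp ((2 * Real.pi * k * x : ℝ) * Complex.I) * z ^ j
        = Complex.exp ((2 * Real.pi * k * (x - j / (K + 1)) : ℝ) * Complex.I) := by
      rw [hz, ← Complex.exp_nat_mul, ← Complex.exp_add, ht]
      congr 1
      push_cast
      field_simp
      ring
    have h2 : ((j : ℂ) / (K + 1) - 1 / 2) = (((j : ℝ) / (K + 1) - 1 / 2 : ℝ) : ℂ) := by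
      push_cast; ring
    rw [mul_left_comm, h1, h2, Complex.re_ofReal_mul, Complex.exp_ofReal_mul_I_re]
  simp_rw [hterm]
  rw [← Complex.re_sum, ← Finset.mul_sum, hsum]
  have h5 : Complex.exp ((2 * Real.pi * k * x : ℝ) * Complex.I)
      * (Complex.I / 2 * (Real.cos t / Real.sin t))
      = ((Real.cos t / Real.sin t / 2 : ℝ) : ℂ)
        * (Complex.I * Complex.exp ((2 * Real.pi * k * x : ℝ) * Complex.I)) := by
    push_cast
    ring
  rw [h5, Complex.re_ofReal_mul, Complex.I_mul_re, Complex.exp_ofReal_mul_I_im]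
  ring

theorem sum_sawtooth (K : ℕ) :
    ∑ j ∈ Finset.Icc 1 K, ((j : ℝ) / (K + 1) - 1 / 2) = 0 := by
  have h (n : ℕ) : ∑ j ∈ Finset.Icc 1 n, (j : ℝ) = n * (n + 1) / 2 := by
    induction n with
    | zero => simp
    | succ n ih =>
      rw [Finset.sum_Icc_succ_top (by omega), ih]
      push_cast
      ring
  have hN : ((K : ℝ) + 1) ≠ 0 := by positivity
  rw [Finset.sum_sub_distrib, ← Finset.sum_div, h]
  simp
  field_simp
  ring

/-- Its term of frequency `K + 1` cancels the isolated sine in `vaaler`, which is why that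
polynomial has degree at most `K`. -/
theorem fejer_mul_sin (K : ℕ) (x : ℝ) :
    fejer K x * Real.sin (2 * Real.pi * x)
      = ∑ k ∈ Finset.Icc 1 K, 2 / ((K : ℝ) + 1) * Real.sin (2 * Real.pi * k * x)
        + 1 / (K + 1) * Real.sin (2 * Real.pi * (K + 1) * x) := by
  have hN : ((K : ℝ) + 1) ≠ 0 := by positivity
  -- Truncating the kernel at `n` leaves two boundary sines. At `n = K` one has coefficient `1 / (K
  -- + 1)` and the other vanishes.
  have key (n : ℕ) : (1 + 2 * ∑ k ∈ Finset.Icc 1 n,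
        (1 - (k : ℝ) / (K + 1)) * Real.cos (2 * Real.pi * k * x)) * Real.sin (2 * Real.pi * x)
      = ∑ k ∈ Finset.Icc 1 n, 2 / ((K : ℝ) + 1) * Real.sin (2 * Real.pi * k * x)
        + (1 - n / (K + 1)) * Real.sin (2 * Real.pi * (n + 1) * x)
        + (1 - (n + 1) / (K + 1)) * Real.sin (2 * Real.pi * n * x) := by
    induction n with
    | zero => simp
    | succ n ih =>
      rw [Finset.sum_Icc_succ_top (by omega), Finset.sum_Icc_succ_top (by omega), mul_add,
        ← add_assoc, add_mul, ih]
      have h1 : Real.sin (2 * Real.pi * ((n + 1 : ℕ) + 1) * x)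
          = Real.sin (2 * Real.pi * (n + 1) * x) * Real.cos (2 * Real.pi * x)
            + Real.cos (2 * Real.pi * (n + 1) * x) * Real.sin (2 * Real.pi * x) := by
        rw [← Real.sin_add]; push_cast; ring_nf
      have h2 : Real.sin (2 * Real.pi * n * x)
          = Real.sin (2 * Real.pi * (n + 1) * x) * Real.cos (2 * Real.pi * x)
            - Real.cos (2 * Real.pi * (n + 1) * x) * Real.sin (2 * Real.pi * x) := by
        rw [← Real.sin_sub]; ring_nf
      rw [h1, h2]
      generalize ∑ k ∈ Finset.Icc 1 n, 2 / ((K : ℝ) + 1) * Real.sin (2 * Real.pi * k * x) = S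
      push_cast
      field_simp
      ring
  unfold fejer
  rw [key K]
  have h3 : (1 : ℝ) - K / (K + 1) = 1 / (K + 1) := by field_simp; ring
  have h4 : (1 : ℝ) - (K + 1) / (K + 1) = 0 := by rw [div_self hN, sub_self]
  rw [h3, h4]
  ring

/-- The coefficient of Vaaler's polynomial. -/
noncomputable def vaalerCoeff (K k : ℕ) : ℝ :=
  ((1 - (k : ℝ) / (K + 1)) * (Real.cos (Real.pi * k / (K + 1)) / Real.sin (Real.pi * k / (K + 1)))
    + 1 / Real.pi) / (K + 1)

theorem vaaler_eq (K : ℕ) (x : ℝ) :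
    vaaler K x = -∑ k ∈ Finset.Icc 1 K, vaalerCoeff K k * Real.sin (2 * Real.pi * k * x) := by
  have hN : ((K : ℝ) + 1) ≠ 0 := by positivity
  have h1 : ∑ j ∈ Finset.Icc 1 K, ((j : ℝ) / (K + 1) - 1 / 2) * fejer K (x - j / (K + 1))
      = ∑ k ∈ Finset.Icc 1 K, (1 - (k : ℝ) / (K + 1))
        * (-(Real.cos (Real.pi * k / (K + 1)) / Real.sin (Real.pi * k / (K + 1)))
          * Real.sin (2 * Real.pi * k * x)) := by
    unfold fejer
    simp_rw [mul_add, mul_one]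
    rw [Finset.sum_add_distrib, sum_sawtooth, zero_add]
    simp_rw [Finset.mul_sum]
    rw [Finset.sum_comm]
    refine Finset.sum_congr rfl fun k hk => ?_
    have h2 : ∀ j : ℕ, ((j : ℝ) / (K + 1) - 1 / 2)
        * (2 * ((1 - (k : ℝ) / (K + 1)) * Real.cos (2 * Real.pi * k * (x - j / (K + 1)))))
        = 2 * (1 - (k : ℝ) / (K + 1)) * (((j : ℝ) / (K + 1) - 1 / 2)
          * Real.cos (2 * Real.pi * k * (x - j / (K + 1)))) := fun j => by ring
    simp_rw [h2]
    rw [← Finset.mul_sum, sum_sawtooth_cos hk]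
    ring
  unfold vaaler
  have h3 : ∑ k ∈ Finset.Icc 1 K, vaalerCoeff K k * Real.sin (2 * Real.pi * k * x)
      = -(1 / ((K : ℝ) + 1) * ∑ k ∈ Finset.Icc 1 K, (1 - (k : ℝ) / (K + 1))
        * (-(Real.cos (Real.pi * k / (K + 1)) / Real.sin (Real.pi * k / (K + 1)))
          * Real.sin (2 * Real.pi * k * x)))
        + 1 / (2 * Real.pi) * ∑ k ∈ Finset.Icc 1 K, 2 / ((K : ℝ) + 1)
          * Real.sin (2 * Real.pi * k * x) := by
    rw [Finset.mul_sum, Finset.mul_sum, ← Finset.sum_neg_distrib, ← Finset.sum_add_distrib]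
    refine Finset.sum_congr rfl fun k _ => ?_
    unfold vaalerCoeff
    have := Real.pi_ne_zero
    field_simp
  rw [h1, mul_assoc (1 / (2 * Real.pi)), fejer_mul_sin, h3]
  have := Real.pi_ne_zero
  generalize ∑ k ∈ Finset.Icc 1 K, (1 - (k : ℝ) / (K + 1))
    * (-(Real.cos (Real.pi * k / (K + 1)) / Real.sin (Real.pi * k / (K + 1)))
      * Real.sin (2 * Real.pi * k * x)) = S
  generalize ∑ k ∈ Finset.Icc 1 K, 2 / ((K : ℝ) + 1) * Real.sin (2 * Real.pi * k * x) = S'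
  field_simp
  ring

/-- The Fourier coefficients of the Beurling–Selberg polynomials, with `s = 1` for the majorant
and `s = -1` for the minorant. -/
noncomputable def selbergCoeff (s : ℝ) (K : ℕ) (β : ℝ) (k : ℕ) : ℝ :=
  vaalerCoeff K k * Real.sin (Real.pi * k * β)
    + s * ((1 - (k : ℝ) / (K + 1)) * Real.cos (Real.pi * k * β) / (K + 1))

theorem fejer_neg (K : ℕ) (x : ℝ) : fejer K (-x) = fejer K x := by
  unfold fejer
  simp

theorem vaaler_neg (K : ℕ) (x : ℝ) : vaaler K (-x) = -vaaler K x := by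
  rw [vaaler_eq, vaaler_eq, ← Finset.sum_neg_distrib]
  simp

/-- Shifting by `±β / 2` turns the odd Vaaler part into cosines weighted by `sin (π k β)`, and the
even Fejér part into cosines weighted by `cos (π k β)`. Only the sign `s` of the latter differs
between majorant and minorant. -/
theorem selberg_eq (s : ℝ) (K : ℕ) (β x : ℝ) :
    β + vaaler K (x - β / 2) - vaaler K (x + β / 2)
        + s * (1 / (2 * (K + 1)) * (fejer K (x - β / 2) + fejer K (x + β / 2)))
      = (β + s / (K + 1)) + ∑ k ∈ Finset.Icc 1 K,
        selbergCoeff s K β k * (2 * Real.cos (2 * Real.pi * (k * x))) := by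
  have hN : ((K : ℝ) + 1) ≠ 0 := by positivity
  have h1 : vaaler K (x - β / 2) - vaaler K (x + β / 2) = ∑ k ∈ Finset.Icc 1 K,
      vaalerCoeff K k * Real.sin (Real.pi * k * β) * (2 * Real.cos (2 * Real.pi * (k * x))) := by
    rw [vaaler_eq, vaaler_eq, ← Finset.sum_neg_distrib, ← Finset.sum_neg_distrib,
      ← Finset.sum_sub_distrib]
    refine Finset.sum_congr rfl fun k _ => ?_
    have e1 : 2 * Real.pi * k * (x - β / 2) = 2 * Real.pi * (k * x) - Real.pi * k * β := by ring
    have e2 : 2 * Real.pi * k * (x + β / 2) = 2 * Real.pi * (k * x) + Real.pi * k * β := by ring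
    rw [e1, e2, Real.sin_sub, Real.sin_add]
    ring
  have h2 : fejer K (x - β / 2) + fejer K (x + β / 2) = 2 + ∑ k ∈ Finset.Icc 1 K,
      (2 * ((1 - (k : ℝ) / (K + 1)) * Real.cos (Real.pi * k * β)))
        * (2 * Real.cos (2 * Real.pi * (k * x))) := by
    unfold fejer
    rw [Finset.mul_sum, Finset.mul_sum, add_add_add_comm, ← Finset.sum_add_distrib]
    congr 1
    · norm_num
    refine Finset.sum_congr rfl fun k _ => ?_
    have e1 : 2 * Real.pi * k * (x - β / 2) = 2 * Real.pi * (k * x) - Real.pi * k * β := by ring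
    have e2 : 2 * Real.pi * k * (x + β / 2) = 2 * Real.pi * (k * x) + Real.pi * k * β := by ring
    rw [e1, e2, Real.cos_sub, Real.cos_add]
    ring
  have h3 : ∑ k ∈ Finset.Icc 1 K, selbergCoeff s K β k * (2 * Real.cos (2 * Real.pi * (k * x)))
      = ∑ k ∈ Finset.Icc 1 K,
        vaalerCoeff K k * Real.sin (Real.pi * k * β) * (2 * Real.cos (2 * Real.pi * (k * x)))
      + s * (1 / (2 * ((K : ℝ) + 1)) * ∑ k ∈ Finset.Icc 1 K,
        (2 * ((1 - (k : ℝ) / (K + 1)) * Real.cos (Real.pi * k * β)))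
          * (2 * Real.cos (2 * Real.pi * (k * x)))) := by
    rw [Finset.mul_sum, Finset.mul_sum, ← Finset.sum_add_distrib]
    refine Finset.sum_congr rfl fun k _ => ?_
    unfold selbergCoeff
    field_simp
  rw [add_sub_assoc, h3, h1, h2]
  generalize ∑ k ∈ Finset.Icc 1 K,
    vaalerCoeff K k * Real.sin (Real.pi * k * β) * (2 * Real.cos (2 * Real.pi * (k * x))) = S
  generalize ∑ k ∈ Finset.Icc 1 K, (2 * ((1 - (k : ℝ) / (K + 1)) * Real.cos (Real.pi * k * β)))
    * (2 * Real.cos (2 * Real.pi * (k * x))) = S'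
  field_simp
  ring

theorem selbergPlus_eq (K : ℕ) (β x : ℝ) :
    selbergPlus K β x = (β + 1 / (K + 1)) + ∑ k ∈ Finset.Icc 1 K,
      selbergCoeff 1 K β k * (2 * Real.cos (2 * Real.pi * (k * x))) := by
  rw [← selberg_eq]
  unfold selbergPlus beurling
  have h : -β / 2 - x = -(x + β / 2) := by ring
  rw [h, vaaler_neg, fejer_neg]
  ring

theorem selbergMinus_eq (K : ℕ) (β x : ℝ) :
    selbergMinus K β x = (β + -1 / (K + 1)) + ∑ k ∈ Finset.Icc 1 K,
      selbergCoeff (-1) K β k * (2 * Real.cos (2 * Real.pi * (k * x))) := by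
  rw [← selberg_eq]
  unfold selbergMinus beurling
  have h : β / 2 - x = -(x - β / 2) := by ring
  rw [h, vaaler_neg, fejer_neg]
  ring

theorem fourierCoefficient_selbergPlus {K k : ℕ} (β : ℝ) (hk : k ∈ Finset.Icc 1 K) :
    fourierCoefficient (selbergPlus K β) k = selbergCoeff 1 K β k := by
  rw [funext (selbergPlus_eq K β)]
  exact fourierCoefficient_cos_sum _ _ hk

theorem fourierCoefficient_selbergMinus {K k : ℕ} (β : ℝ) (hk : k ∈ Finset.Icc 1 K) :
    fourierCoefficient (selbergMinus K β) k = selbergCoeff (-1) K β k := by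
  rw [funext (selbergMinus_eq K β)]
  exact fourierCoefficient_cos_sum _ _ hk

theorem mul_cos_div_sin_bounds {x : ℝ} (h0 : 0 < x) (h1 : x ≤ Real.pi / 2) :
    0 ≤ x * (Real.cos x / Real.sin x) ∧ 1 - x ^ 2 / 2 ≤ x * (Real.cos x / Real.sin x) ∧
      x * (Real.cos x / Real.sin x) ≤ 1 := by
  have hpi := Real.pi_pos
  have hs : 0 < Real.sin x := Real.sin_pos_of_pos_of_lt_pi h0 (by linarith)
  have hc : 0 ≤ Real.cos x := Real.cos_nonneg_of_mem_Icc ⟨by linarith, h1⟩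
  refine ⟨by positivity, ?_, ?_⟩
  · refine Real.one_sub_sq_div_two_le_cos.trans ?_
    rw [mul_div_assoc', le_div_iff₀ hs, mul_comm]
    exact mul_le_mul_of_nonneg_right (Real.sin_le h0.le) hc
  · rw [mul_div_assoc', div_le_one hs]
    -- The bound `x ≤ tan x` is only available for `x < π / 2`; at the endpoint the cotangent is
    -- `0`.
    rcases h1.lt_or_eq with h | h
    · have h2 := Real.le_tan h0.le h
      have hc' : 0 < Real.cos x := Real.cos_pos_of_mem_Ioo ⟨by linarith, h⟩
      rwa [Real.tan_eq_sin_div_cos, le_div_iff₀ hc'] at h2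
    · rw [h, Real.cos_pi_div_two, mul_zero, Real.sin_pi_div_two]
      exact zero_le_one

/-- For `u ≤ 1/2` this follows from `x cot x = 1 + O(x ^ 2)`; beyond, the reflection `u ↦ 1 - u`
brings the cotangent back to that range. -/
theorem abs_vaaler_symbol_sub_one_le {u : ℝ} (h0 : 0 < u) (h1 : u < 1) :
    |Real.pi * u * ((1 - u) * (Real.cos (Real.pi * u) / Real.sin (Real.pi * u)) + 1 / Real.pi) - 1|
      ≤ 3 * u := by
  have hpi := Real.pi_pos
  have hpi4 := Real.pi_lt_d2
  have e0 : Real.pi * u * ((1 - u) * (Real.cos (Real.pi * u) / Real.sin (Real.pi * u))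
      + 1 / Real.pi) = (1 - u) * ((Real.pi * u) * (Real.cos (Real.pi * u) / Real.sin (Real.pi * u)))
      + u := by
    field_simp
  rw [e0]
  rcases le_or_gt u (1 / 2) with h | h
  · obtain ⟨b0, b1, b2⟩ := mul_cos_div_sin_bounds (x := Real.pi * u) (by positivity) (by nlinarith)
    set T := (Real.pi * u) * (Real.cos (Real.pi * u) / Real.sin (Real.pi * u))
    have hb : 1 - T ≤ 3 * u := by
      have hpi2 : Real.pi ^ 2 ≤ 10 := by nlinarith
      have : (Real.pi * u) ^ 2 / 2 ≤ 3 * u := by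
        have h3 : (Real.pi * u) ^ 2 = Real.pi ^ 2 * (u * u) := by ring
        have h4 : Real.pi ^ 2 * (u * u) ≤ 10 * (u * (1 / 2)) := by gcongr
        linarith
      linarith
    rw [abs_le]
    constructor
    · nlinarith
    · nlinarith
  · set v := 1 - u with hv
    obtain ⟨b0, -, b2⟩ := mul_cos_div_sin_bounds (x := Real.pi * v) (by
      have : 0 < v := by linarith
      positivity) (by nlinarith)
    have hcos : Real.cos (Real.pi * u) = -Real.cos (Real.pi * v) := by
      rw [← Real.cos_pi_sub, hv]; ring_nf
    have hsin : Real.sin (Real.pi * u) = Real.sin (Real.pi * v) := by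
      rw [← Real.sin_pi_sub, hv]; ring_nf
    rw [hcos, hsin]
    have e1 : v * (Real.pi * u * (-Real.cos (Real.pi * v) / Real.sin (Real.pi * v))) + u - 1
        = -(u * (Real.pi * v * (Real.cos (Real.pi * v) / Real.sin (Real.pi * v)))) + u - 1 := by
      ring
    rw [e1]
    set T := Real.pi * v * (Real.cos (Real.pi * v) / Real.sin (Real.pi * v))
    rw [abs_le]
    constructor <;> nlinarith

/-- The coefficients are nearly those of the indicator function of the interval. The Vaaler symbol
costs `3 / π ≤ 1` times `1 / (K + 1)`, and the Fejér term another `1 / (K + 1)`. -/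
theorem abs_selbergCoeff_sub_le {s : ℝ} (hs : |s| = 1) {K k : ℕ} (β : ℝ)
    (hk : k ∈ Finset.Icc 1 K) :
    |selbergCoeff s K β k - Real.sin (Real.pi * k * β) / (Real.pi * k)| ≤ 2 / (K + 1) := by
  obtain ⟨hk1, hkK⟩ := Finset.mem_Icc.1 hk
  have hN : (0 : ℝ) < K + 1 := by positivity
  have hk0 : (0 : ℝ) < k := by exact_mod_cast hk1
  have hpi := Real.pi_pos
  have hpi3 := Real.pi_gt_three
  have hu1 : (k : ℝ) / (K + 1) < 1 := by
    rw [div_lt_one hN]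
    exact_mod_cast Nat.lt_succ_of_le hkK
  have h1 := abs_vaaler_symbol_sub_one_le (u := k / (K + 1)) (by positivity) hu1
  have e1 : selbergCoeff s K β k - Real.sin (Real.pi * k * β) / (Real.pi * k)
      = Real.sin (Real.pi * k * β) / (Real.pi * k) * (Real.pi * (k / (K + 1))
        * ((1 - k / (K + 1)) * (Real.cos (Real.pi * (k / (K + 1)))
          / Real.sin (Real.pi * (k / (K + 1)))) + 1 / Real.pi) - 1)
        + s * ((1 - (k : ℝ) / (K + 1)) * Real.cos (Real.pi * k * β) / (K + 1)) := by
    unfold selbergCoeff vaalerCoeff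
    rw [mul_div_assoc Real.pi (k : ℝ)]
    field_simp
    ring
  rw [e1]
  refine (abs_add_le _ _).trans ?_
  have b1 : |Real.sin (Real.pi * k * β) / (Real.pi * k) * (Real.pi * (k / (K + 1))
        * ((1 - k / (K + 1)) * (Real.cos (Real.pi * (k / (K + 1)))
          / Real.sin (Real.pi * (k / (K + 1)))) + 1 / Real.pi) - 1)| ≤ 1 / (K + 1) := by
    rw [abs_mul, abs_div, abs_of_pos (mul_pos hpi hk0)]
    calc _ ≤ 1 / (Real.pi * k) * (3 * (k / (K + 1))) := by
          gcongr
          exact Real.abs_sin_le_one _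
      _ = 3 / Real.pi * (1 / (K + 1)) := by field_simp
      _ ≤ 1 * (1 / (K + 1)) := by
          gcongr
          rw [div_le_one hpi]
          exact hpi3.le
      _ = _ := one_mul _
  have b2 : |s * ((1 - (k : ℝ) / (K + 1)) * Real.cos (Real.pi * k * β) / (K + 1))|
      ≤ 1 / (K + 1) := by
    rw [abs_mul, hs, one_mul, abs_div, abs_mul, abs_of_pos hN,
      abs_of_pos (show (0 : ℝ) < 1 - k / (K + 1) by linarith)]
    gcongr
    have : (1 : ℝ) - k / (K + 1) ≤ 1 := by
      have : (0 : ℝ) < k / (K + 1) := by positivity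
      linarith
    calc _ ≤ (1 : ℝ) * 1 := by
          gcongr
          exact Real.abs_cos_le_one _
      _ = 1 := one_mul 1
  calc _ ≤ 1 / ((K : ℝ) + 1) + 1 / (K + 1) := add_le_add b1 b2
    _ = _ := by ring

end Fourier

/-! ### The variance -/

section Variance

theorem abs_sum_sub_div_le {D : ℕ → ℝ} (hD : ∀ n, |D n| ≤ 1) {m n : ℕ} (hm : 0 < m) (hmn : m ≤ n) :
    |∑ j ∈ Finset.Ioc m n, (D j - D (j - 1)) / j| ≤ 2 / m := by
  have hm0 : (0 : ℝ) < m := by exact_mod_cast hm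
  -- Summation by parts, made inductive: with the boundary term `D n / n` subtracted, the bound
  -- telescopes.
  have key : |∑ j ∈ Finset.Ioc m n, (D j - D (j - 1)) / j - D n / n| ≤ 2 / m - 1 / n := by
    induction n, hmn using Nat.le_induction with
    | base =>
      rw [Finset.Ioc_self, Finset.sum_empty, zero_sub, abs_neg, abs_div, Nat.abs_cast]
      have : |D m| / m ≤ 1 / m := by gcongr; exact hD m
      have h2 : (2 : ℝ) / m - 1 / m = 1 / m := by ring
      linarith
    | succ n hmn ih =>
      have hn0 : (0 : ℝ) < n := by exact_mod_cast hm.trans_le hmn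
      rw [← Finset.insert_Ioc_right_eq_Ioc_add_one (by omega), Finset.sum_insert (by simp),
        Nat.add_sub_cancel]
      have e1 : (D (n + 1) - D n) / ((n + 1 : ℕ) : ℝ) + ∑ j ∈ Finset.Ioc m n, (D j - D (j - 1)) / j
          - D (n + 1) / ((n + 1 : ℕ) : ℝ)
          = (∑ j ∈ Finset.Ioc m n, (D j - D (j - 1)) / j - D n / n)
            + D n * (1 / n - 1 / ((n + 1 : ℕ) : ℝ)) := by
        ring
      rw [e1]
      have h1 : (0 : ℝ) ≤ 1 / n - 1 / ((n + 1 : ℕ) : ℝ) := by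
        rw [sub_nonneg]
        gcongr
        omega
      have h2 : |D n * (1 / n - 1 / ((n + 1 : ℕ) : ℝ))| ≤ 1 / n - 1 / ((n + 1 : ℕ) : ℝ) := by
        rw [abs_mul, abs_of_nonneg h1]
        exact mul_le_of_le_one_left h1 (hD n)
      exact (abs_add_le _ _).trans (by linarith)
  have h3 : |D n / n| ≤ 1 / n := by
    rw [abs_div, Nat.abs_cast]
    gcongr
    exact hD n
  calc |∑ j ∈ Finset.Ioc m n, (D j - D (j - 1)) / j|
      = |(∑ j ∈ Finset.Ioc m n, (D j - D (j - 1)) / j - D n / n) + D n / n| := by ring_nf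
    _ ≤ _ := (abs_add_le _ _).trans (by linarith)

/-- Multiplied by `2 sin (π β)`, the cosines become differences of consecutive values of `sin ((2j +
1) π β)`, so summation by parts applies. -/
theorem abs_sum_cos_div_le {β : ℝ} (hs : 0 < Real.sin (Real.pi * β)) {m n : ℕ} (hm : 0 < m)
    (hmn : m ≤ n) :
    |∑ j ∈ Finset.Ioc m n, Real.cos (2 * (Real.pi * j * β)) / j|
      ≤ 1 / (m * Real.sin (Real.pi * β)) := by
  have h := abs_sum_sub_div_le (D := fun j : ℕ => Real.sin ((2 * j + 1) * (Real.pi * β)))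
    (fun j => Real.abs_sin_le_one _) hm hmn
  have e1 : ∑ j ∈ Finset.Ioc m n, (Real.sin ((2 * (j : ℕ) + 1) * (Real.pi * β))
        - Real.sin ((2 * ((j - 1 : ℕ) : ℝ) + 1) * (Real.pi * β))) / j
      = 2 * Real.sin (Real.pi * β) * ∑ j ∈ Finset.Ioc m n, Real.cos (2 * (Real.pi * j * β)) / j := by
    rw [Finset.mul_sum]
    refine Finset.sum_congr rfl fun j hj => ?_
    have hj1 : 1 ≤ j := by have := (Finset.mem_Ioc.1 hj).1; omega
    rw [Nat.cast_sub hj1, Nat.cast_one]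
    have e2 : (2 * (j : ℝ) + 1) * (Real.pi * β) = 2 * (Real.pi * j * β) + Real.pi * β := by ring
    have e3 : (2 * ((j : ℝ) - 1) + 1) * (Real.pi * β) = 2 * (Real.pi * j * β) - Real.pi * β := by
      ring
    rw [e2, e3, Real.sin_add, Real.sin_sub]
    ring
  rw [e1, abs_mul, abs_of_pos (by positivity : 0 < 2 * Real.sin (Real.pi * β))] at h
  have hm0 : (0 : ℝ) < m := by exact_mod_cast hm
  rw [le_div_iff₀ (by positivity)]
  rw [le_div_iff₀ hm0] at h
  nlinarith

theorem abs_harmonic_sub_log_le {n : ℕ} (hn : 0 < n) :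
    0 ≤ ∑ j ∈ Finset.Ioc 0 n, (1 : ℝ) / j - Real.log n ∧
      ∑ j ∈ Finset.Ioc 0 n, (1 : ℝ) / j - Real.log n ≤ 1 := by
  have h0 : ((harmonic n : ℚ) : ℝ) = ∑ j ∈ Finset.Ioc 0 n, (1 : ℝ) / j := by
    rw [harmonic_eq_sum_Icc]
    push_cast
    simp only [one_div]
    rfl
  have h1 := log_add_one_le_harmonic n
  have h2 := harmonic_le_one_add_log n
  have h3 : Real.log n ≤ Real.log (n + 1 : ℕ) := by
    have : (0 : ℝ) < n := by exact_mod_cast hn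
    gcongr
    omega
  rw [h0] at h1 h2
  constructor <;> linarith

/-- The sum is split near `1 / β`. Below, `|sin x| ≤ |x|` makes it bounded. Above, `sin² = (1 - cos
2x) / 2` gives half a harmonic sum, that is `log (K β) / 2 + O(1)`, and an oscillating sum bounded
by `1 / c₀`. -/
theorem abs_sum_sin_sq_div_sub_log_le {c₀ β : ℝ} {K : ℕ} (hc₀ : 0 < c₀) (hβ0 : 0 < β) (hβ1 : β < 1)
    (hs : c₀ * β ≤ Real.sin (Real.pi * β)) (hK : 1 ≤ K * β) :
    |∑ j ∈ Finset.Icc 1 K, Real.sin (Real.pi * j * β) ^ 2 / j - Real.log (K * β) / 2|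
      ≤ 4 * Real.pi ^ 2 + 1 + 1 / c₀ := by
  set n := ⌈1 / β⌉₊ with hn
  have hs0 : 0 < Real.sin (Real.pi * β) := (mul_pos hc₀ hβ0).trans_le hs
  have hn1 : 1 / β ≤ n := Nat.le_ceil _
  have hn2 : (n : ℝ) < 1 / β + 1 := Nat.ceil_lt_add_one (by positivity)
  have hnβ1 : 1 ≤ n * β := by rwa [div_le_iff₀ hβ0] at hn1
  have hnβ2 : n * β ≤ 2 := by
    have : (n : ℝ) * β < (1 / β + 1) * β := by gcongr
    rw [add_mul, one_div, inv_mul_cancel₀ hβ0.ne'] at this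
    linarith
  have hnK : n ≤ K := by
    rw [hn, Nat.ceil_le, div_le_iff₀ hβ0]
    exact hK
  have hn0 : 0 < n := Nat.ceil_pos.2 (by positivity)
  have hn0' : (0 : ℝ) < n := by exact_mod_cast hn0
  have hK0 : 0 < K := hn0.trans_le hnK
  have hK0' : (0 : ℝ) < K := by exact_mod_cast hK0
  have hI : Finset.Icc 1 K = Finset.Ioc 0 K := rfl
  rw [hI, ← Finset.sum_Ioc_consecutive _ (Nat.zero_le n) hnK]
  have hfirst0 : 0 ≤ ∑ j ∈ Finset.Ioc 0 n, Real.sin (Real.pi * j * β) ^ 2 / j :=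
    Finset.sum_nonneg fun j _ => by positivity
  have hfirst : ∑ j ∈ Finset.Ioc 0 n, Real.sin (Real.pi * j * β) ^ 2 / j ≤ 4 * Real.pi ^ 2 := by
    have hterm : ∀ j ∈ Finset.Ioc 0 n, Real.sin (Real.pi * j * β) ^ 2 / j
        ≤ Real.pi ^ 2 * (n * β) * β := by
      intro j hj
      obtain ⟨hj0, hjn⟩ := Finset.mem_Ioc.1 hj
      have hj0' : (0 : ℝ) < j := by exact_mod_cast hj0
      have hjn' : (j : ℝ) ≤ n := by exact_mod_cast hjn
      rw [div_le_iff₀ hj0']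
      have h1 : Real.sin (Real.pi * j * β) ^ 2 ≤ (Real.pi * j * β) ^ 2 :=
        sq_le_sq.2 Real.abs_sin_le_abs
      refine h1.trans ?_
      have h2 : (Real.pi * j * β) ^ 2 = Real.pi ^ 2 * (j * β) * β * j := by ring
      rw [h2]
      gcongr
    refine (Finset.sum_le_card_nsmul _ _ _ hterm).trans ?_
    rw [Nat.card_Ioc, nsmul_eq_mul, Nat.sub_zero]
    calc (n : ℝ) * (Real.pi ^ 2 * (n * β) * β) = Real.pi ^ 2 * ((n * β) * (n * β)) := by ring
      _ ≤ Real.pi ^ 2 * (2 * 2) := by gcongr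
      _ = _ := by ring
  have hsecond : ∑ j ∈ Finset.Ioc n K, Real.sin (Real.pi * j * β) ^ 2 / j
      = (∑ j ∈ Finset.Ioc 0 K, (1 : ℝ) / j - ∑ j ∈ Finset.Ioc 0 n, (1 : ℝ) / j) / 2
        - (∑ j ∈ Finset.Ioc n K, Real.cos (2 * (Real.pi * j * β)) / j) / 2 := by
    rw [← Finset.sum_Ioc_consecutive (fun j : ℕ => (1 : ℝ) / j) (Nat.zero_le n) hnK,
      add_sub_cancel_left, ← sub_div, ← Finset.sum_sub_distrib, Finset.sum_div]
    refine Finset.sum_congr rfl fun j _ => ?_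
    rw [Real.cos_two_mul, Real.sin_sq]
    ring
  have hcos := abs_sum_cos_div_le hs0 hn0 hnK
  have hcos' : 1 / (n * Real.sin (Real.pi * β)) ≤ 1 / c₀ := by
    gcongr
    calc c₀ = c₀ * 1 := (mul_one _).symm
      _ ≤ c₀ * (n * β) := by gcongr
      _ = n * (c₀ * β) := by ring
      _ ≤ _ := by gcongr
  obtain ⟨a1, a2⟩ := abs_harmonic_sub_log_le hK0
  obtain ⟨b1, b2⟩ := abs_harmonic_sub_log_le hn0
  have hl1 : Real.log (K * β) = Real.log K + Real.log β := Real.log_mul hK0'.ne' hβ0.ne'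
  have hl2 : Real.log (n * β) = Real.log n + Real.log β := Real.log_mul hn0'.ne' hβ0.ne'
  have hl3 : 0 ≤ Real.log (n * β) := Real.log_nonneg hnβ1
  have hl4 : Real.log (n * β) ≤ 1 := by
    have := Real.log_le_sub_one_of_pos (x := n * β) (by positivity)
    linarith
  have hcos2 := abs_le.1 (hcos.trans hcos')
  have hc1 : 0 < 1 / c₀ := by positivity
  have hpi := sq_nonneg Real.pi
  rw [hsecond, abs_le]
  constructor <;> linarith [hcos2.1, hcos2.2]

theorem mul_abs_selbergCoeff_le {s : ℝ} (hs : |s| = 1) {K k : ℕ} (β : ℝ)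
    (hk : k ∈ Finset.Icc 1 K) : k * |selbergCoeff s K β k| ≤ 3 := by
  obtain ⟨hk1, hkK⟩ := Finset.mem_Icc.1 hk
  have hk0 : (0 : ℝ) < k := by exact_mod_cast hk1
  have hkN : (k : ℝ) ≤ K + 1 := by exact_mod_cast (by omega : k ≤ K + 1)
  have hN : (0 : ℝ) < K + 1 := by positivity
  have hpi := Real.pi_gt_three
  have h1 := abs_selbergCoeff_sub_le hs β hk
  have h2 : |Real.sin (Real.pi * k * β) / (Real.pi * k)| ≤ 1 / k := by
    rw [abs_div, abs_of_pos (by positivity : 0 < Real.pi * k)]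
    gcongr
    · exact Real.abs_sin_le_one _
    · nlinarith
  have h3 : |selbergCoeff s K β k| ≤ 2 / (K + 1) + 1 / k := by
    calc |selbergCoeff s K β k| = |(selbergCoeff s K β k - Real.sin (Real.pi * k * β) / (Real.pi * k))
          + Real.sin (Real.pi * k * β) / (Real.pi * k)| := by ring_nf
      _ ≤ _ := (abs_add_le _ _).trans (add_le_add h1 h2)
  calc k * |selbergCoeff s K β k| ≤ k * (2 / (K + 1) + 1 / k) := by gcongr
    _ = 2 * (k / (K + 1)) + 1 := by field_simp
    _ ≤ 2 * 1 + 1 := by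
        gcongr
        rw [div_le_one hN]
        exact hkN
    _ = 3 := by norm_num

theorem abs_sum_selbergCoeff_sq_sub_le {s : ℝ} (hs : |s| = 1) (K : ℕ) (β : ℝ) :
    |∑ m ∈ Finset.Icc 1 K, m * selbergCoeff s K β m ^ 2
        - 1 / Real.pi ^ 2 * ∑ m ∈ Finset.Icc 1 K, Real.sin (Real.pi * m * β) ^ 2 / m| ≤ 8 := by
  have hN : (0 : ℝ) < K + 1 := by positivity
  have hpi := Real.pi_gt_three
  rw [Finset.mul_sum, ← Finset.sum_sub_distrib]
  have hterm : ∀ m ∈ Finset.Icc 1 K, |(m : ℝ) * selbergCoeff s K β m ^ 2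
      - 1 / Real.pi ^ 2 * (Real.sin (Real.pi * m * β) ^ 2 / m)| ≤ 8 / ((K : ℝ) + 1) := by
    intro m hm
    obtain ⟨hm1, hmK⟩ := Finset.mem_Icc.1 hm
    have hm0 : (0 : ℝ) < m := by exact_mod_cast hm1
    have hmN : (m : ℝ) ≤ K + 1 := by exact_mod_cast (by omega : m ≤ K + 1)
    have h1 := abs_selbergCoeff_sub_le hs β hm
    set r := selbergCoeff s K β m - Real.sin (Real.pi * m * β) / (Real.pi * m) with hr
    -- Difference of squares: `|r| ≤ 2 / (K + 1)` and the other factor is at most `4`, so the `K`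
    -- terms add up to at most `8`.
    have e1 : m * selbergCoeff s K β m ^ 2 - 1 / Real.pi ^ 2 * (Real.sin (Real.pi * m * β) ^ 2 / m)
        = r * (2 * (Real.sin (Real.pi * m * β) / Real.pi) + m * r) := by
      have : selbergCoeff s K β m = Real.sin (Real.pi * m * β) / (Real.pi * m) + r := by
        rw [hr]; ring
      rw [this]
      field_simp
      ring
    have h2 : |Real.sin (Real.pi * m * β) / Real.pi| ≤ 1 := by
      rw [abs_div, abs_of_pos Real.pi_pos, div_le_one Real.pi_pos]
      exact (Real.abs_sin_le_one _).trans (by linarith)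
    have h3 : |m * r| ≤ 2 := by
      rw [abs_mul, Nat.abs_cast]
      calc (m : ℝ) * |r| ≤ (K + 1) * (2 / (K + 1)) := by gcongr
        _ = 2 := by field_simp
    rw [e1, abs_mul]
    calc |r| * |2 * (Real.sin (Real.pi * m * β) / Real.pi) + m * r| ≤ 2 / (K + 1) * 4 := by
          gcongr
          refine (abs_add_le _ _).trans ?_
          rw [abs_mul, abs_two]
          linarith
      _ = _ := by ring
  refine (Finset.abs_sum_le_sum_abs _ _).trans ((Finset.sum_le_card_nsmul _ _ _ hterm).trans ?_)
  rw [Nat.card_Icc, nsmul_eq_mul, Nat.add_sub_cancel, mul_div_assoc', div_le_iff₀ hN]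
  linarith

theorem abs_variance_sub_log_le {c₀ β s : ℝ} {K : ℕ} (hs1 : |s| = 1) (hc₀ : 0 < c₀) (hβ0 : 0 < β)
    (hβ1 : β < 1) (hs : c₀ * β ≤ Real.sin (Real.pi * β)) (hK : 1 ≤ K * β) :
    |4 * ∑ m ∈ Finset.Icc 1 K, m * selbergCoeff s K β m ^ 2
        - 2 / Real.pi ^ 2 * Real.log (K * β)|
      ≤ 32 + 4 / Real.pi ^ 2 * (4 * Real.pi ^ 2 + 1 + 1 / c₀) := by
  have h1 := abs_sum_selbergCoeff_sq_sub_le hs1 K β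
  have h2 := abs_sum_sin_sq_div_sub_log_le hc₀ hβ0 hβ1 hs hK
  set A := ∑ m ∈ Finset.Icc 1 K, m * selbergCoeff s K β m ^ 2
  set T := ∑ m ∈ Finset.Icc 1 K, Real.sin (Real.pi * m * β) ^ 2 / m
  have e1 : 4 * A - 2 / Real.pi ^ 2 * Real.log (K * β)
      = 4 * (A - 1 / Real.pi ^ 2 * T) + 4 / Real.pi ^ 2 * (T - Real.log (K * β) / 2) := by ring
  rw [e1]
  refine (abs_add_le _ _).trans (add_le_add ?_ ?_)
  · rw [abs_mul, abs_of_pos (by norm_num : (0 : ℝ) < 4)]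
    linarith
  · rw [abs_mul, abs_of_nonneg (by positivity : 0 ≤ 4 / Real.pi ^ 2)]
    gcongr

end Variance

/-! ### The cutoff -/

section Cutoff

variable {β : ℕ → ℝ}

theorem tendsto_log_log (hy : Tendsto (fun d : ℕ => (d : ℝ) * β d) atTop atTop) :
    Tendsto (fun d : ℕ => Real.log (Real.log (d * β d))) atTop atTop :=
  Real.tendsto_log_atTop.comp (Real.tendsto_log_atTop.comp hy)

theorem eventually_mul_cutoff_le (hy : Tendsto (fun d : ℕ => (d : ℝ) * β d) atTop atTop) (r : ℕ) :
    ∀ᶠ d : ℕ in atTop, r * cutoff d (β d) ≤ d := by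
  filter_upwards [(tendsto_log_log hy).eventually_ge_atTop (max 1 (r : ℝ))] with d hd
  have h0 : 0 < Real.log (Real.log (d * β d)) :=
    zero_lt_one.trans_le ((le_max_left _ _).trans hd)
  have hr : (r : ℝ) ≤ Real.log (Real.log (d * β d)) := (le_max_right _ _).trans hd
  have h1 : (cutoff d (β d) : ℝ) ≤ d / Real.log (Real.log (d * β d)) :=
    Nat.floor_le (by positivity)
  have h2 : (r : ℝ) * cutoff d (β d) ≤ d := by
    calc (r : ℝ) * cutoff d (β d)
        ≤ Real.log (Real.log (d * β d)) * (d / Real.log (Real.log (d * β d))) := by gcongr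
      _ = d := by field_simp
  exact_mod_cast h2

theorem eventually_cutoff_bounds (hβ : ∀ d, 0 < β d ∧ β d < 1)
    (hy : Tendsto (fun d : ℕ => (d : ℝ) * β d) atTop atTop) :
    ∀ᶠ d : ℕ in atTop, 1 ≤ cutoff d (β d) * β d ∧
      Real.log (cutoff d (β d) * β d) ≤ Real.log (d * β d) ∧
      Real.log (d * β d) - (Real.log 2 + Real.log (Real.log (d * β d)))
        ≤ Real.log (cutoff d (β d) * β d) := by
  have hlog : ∀ᶠ y : ℝ in atTop, Real.log y ≤ y / 2 := by
    filter_upwards [Real.isLittleO_log_id_atTop.bound (by norm_num : (0 : ℝ) < 1 / 2),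
      eventually_ge_atTop 1] with y hy1 hy2
    rw [id, Real.norm_of_nonneg (Real.log_nonneg hy2), Real.norm_of_nonneg (by linarith)] at hy1
    linarith
  filter_upwards [(tendsto_log_log hy).eventually_ge_atTop 1, hy.eventually hlog,
    hy.eventually_ge_atTop 1] with d hℓ hL hy1
  obtain ⟨hβ0, hβ1⟩ := hβ d
  set y := (d : ℝ) * β d with hyd
  set L := Real.log y with hLd
  set ℓ := Real.log L with hℓd
  have hy0 : 0 < y := zero_lt_one.trans_le hy1
  have hℓ0 : 0 < ℓ := zero_lt_one.trans_le hℓ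
  have hL0 : 0 < L := by
    -- If `L = 0`, then `ℓ = Real.log 0 = 0` by convention, against `ℓ ≥ 1`.
    rcases (Real.log_nonneg hy1).eq_or_lt with h | h
    · rw [hℓd, hLd, ← h, Real.log_zero] at hℓ0
      exact absurd hℓ0 (lt_irrefl 0)
    · exact h
  have hℓL : ℓ ≤ L := by
    have := Real.log_le_sub_one_of_pos hL0
    linarith
  have hKdef : cutoff d (β d) = ⌊(d : ℝ) / ℓ⌋₊ := rfl
  have hd0 : (0 : ℝ) ≤ d := Nat.cast_nonneg d
  have hK1 : (cutoff d (β d) : ℝ) ≤ d / ℓ := by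
    rw [hKdef]; exact Nat.floor_le (by positivity)
  have hK2 : (d : ℝ) / ℓ < cutoff d (β d) + 1 := by
    rw [hKdef]; exact Nat.lt_floor_add_one _
  have hupper : cutoff d (β d) * β d ≤ y := by
    calc cutoff d (β d) * β d ≤ d / ℓ * β d := by gcongr
      _ ≤ d * β d := by
        gcongr
        exact div_le_self hd0 hℓ
  have h2ℓ : 1 ≤ y / (2 * ℓ) := by
    rw [le_div_iff₀ (by positivity)]
    linarith
  -- Rounding down the cutoff loses less than `β d < 1`, which half of `y / ℓ` absorbs.
  have hlower : y / (2 * ℓ) ≤ cutoff d (β d) * β d := by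
    have h1 : y / ℓ < cutoff d (β d) * β d + 1 := by
      calc y / ℓ = d / ℓ * β d := by rw [hyd]; ring
        _ < (cutoff d (β d) + 1) * β d := by gcongr
        _ = cutoff d (β d) * β d + β d := by ring
        _ < _ := by linarith
    have h2 : y / ℓ = y / (2 * ℓ) + y / (2 * ℓ) := by field_simp; norm_num
    linarith
  have hK0 : 0 < cutoff d (β d) * β d := by linarith
  refine ⟨h2ℓ.trans hlower, Real.log_le_log hK0 hupper, ?_⟩
  calc L - (Real.log 2 + Real.log L) ≤ L - (Real.log 2 + Real.log ℓ) := by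
        gcongr
    _ = Real.log (y / (2 * ℓ)) := by
        rw [Real.log_div hy0.ne' (by positivity), Real.log_mul two_ne_zero hℓ0.ne']
    _ ≤ _ := Real.log_le_log (by positivity) hlower

theorem tendsto_log_cutoff (hβ : ∀ d, 0 < β d ∧ β d < 1)
    (hy : Tendsto (fun d : ℕ => (d : ℝ) * β d) atTop atTop) :
    Tendsto (fun d : ℕ => Real.log (cutoff d (β d) * β d) / Real.log (d * β d)) atTop (𝓝 1) := by
  have hL : Tendsto (fun d : ℕ => Real.log (d * β d)) atTop atTop := Real.tendsto_log_atTop.comp hy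
  have h1 : Tendsto (fun x : ℝ => (Real.log 2 + Real.log x) / x) atTop (𝓝 0) := by
    have a : Tendsto (fun x : ℝ => Real.log 2 / x) atTop (𝓝 0) := tendsto_const_nhds.div_atTop tendsto_id
    have b : Tendsto (fun x : ℝ => Real.log x / x) atTop (𝓝 0) :=
      Real.isLittleO_log_id_atTop.tendsto_div_nhds_zero
    simpa [add_div] using a.add b
  have h2 : Tendsto (fun d : ℕ => 1 - (Real.log 2 + Real.log (Real.log (d * β d)))
      / Real.log (d * β d)) atTop (𝓝 1) := by
    simpa using (h1.comp hL).const_sub 1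
  refine tendsto_of_tendsto_of_tendsto_of_le_of_le' h2 tendsto_const_nhds ?_ ?_
  · filter_upwards [eventually_cutoff_bounds hβ hy, hL.eventually_gt_atTop 0] with d hd hd0
    rw [le_div_iff₀ hd0, sub_mul, one_mul, div_mul_cancel₀ _ hd0.ne']
    exact hd.2.2
  · filter_upwards [eventually_cutoff_bounds hβ hy, hL.eventually_gt_atTop 0] with d hd hd0
    rw [div_le_one hd0]
    exact hd.2.1

/-- This extracts from the two regimes all that is needed: `d β → ∞`, and `sin (π β)` not small
compared with `β`. The latter excludes `β` approaching `1`. For `β → 0`, Jordan's inequality gives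
the constant `2`. -/
theorem exists_mul_le_sin (hβ : ∀ d, 0 < β d ∧ β d < 1)
    (hregime : (∃ β₀ : ℝ, ∀ d, β d = β₀) ∨
      (Tendsto β atTop (𝓝 0) ∧ Tendsto (fun d : ℕ => (d : ℝ) * β d) atTop atTop)) :
    Tendsto (fun d : ℕ => (d : ℝ) * β d) atTop atTop ∧
      ∃ c₀ > 0, ∀ᶠ d in atTop, c₀ * β d ≤ Real.sin (Real.pi * β d) := by
  rcases hregime with ⟨β₀, h⟩ | ⟨h0, hy⟩
  · have hβ₀ : 0 < β₀ ∧ β₀ < 1 := h 0 ▸ hβ 0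
    simp only [h]
    refine ⟨tendsto_natCast_atTop_atTop.atTop_mul_const hβ₀.1, Real.sin (Real.pi * β₀) / β₀,
      div_pos (Real.sin_pos_of_pos_of_lt_pi (mul_pos Real.pi_pos hβ₀.1)
        (mul_lt_of_lt_one_right Real.pi_pos hβ₀.2)) hβ₀.1, ?_⟩
    rw [div_mul_cancel₀ _ hβ₀.1.ne']
    exact Eventually.of_forall fun _ => le_rfl
  · refine ⟨hy, 2, two_pos, ?_⟩
    filter_upwards [h0.eventually_le_const (by norm_num : (0 : ℝ) < 1 / 2)] with d hd
    have h1 := Real.mul_le_sin (x := Real.pi * β d) (mul_pos Real.pi_pos (hβ d).1).le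
      (by nlinarith [Real.pi_pos])
    have h2 : 2 / Real.pi * (Real.pi * β d) = 2 * β d := by
      have := Real.pi_ne_zero
      field_simp
    linarith

end Cutoff

/-! ### Convergence in distribution -/

section Limit

/-- Lévy's continuity theorem for random variables along a countably generated filter. -/
theorem tendstoInDistribution_of_tendsto_charFun {D : Type*} {l : Filter D}
    [l.IsCountablyGenerated] {Ω : D → Type*} {mΩ : ∀ d, MeasurableSpace (Ω d)}
    {μ : ∀ d, Measure (Ω d)} [∀ d, IsProbabilityMeasure (μ d)] {X : ∀ d, Ω d → ℝ}
    (hX : ∀ d, Measurable (X d))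
    (h : ∀ t : ℝ, Tendsto (fun d => charFun ((μ d).map (X d)) t) l
      (𝓝 (charFun (gaussianReal 0 1) t))) :
    TendstoInDistribution X l (id : ℝ → ℝ) μ (gaussianReal 0 1) where
  forall_aemeasurable d := (hX d).aemeasurable
  aemeasurable_limit := aemeasurable_id
  tendsto := by
    refine tendsto_of_seq_tendsto fun u hu => ?_
    refine ProbabilityMeasure.tendsto_of_tendsto_charFun fun t => ?_
    simp only [ProbabilityMeasure.coe_mk, Measure.map_id]
    exact (h t).comp hu

variable {F : Type*} [Field F] [Finite F] {p : ℕ} [Fact p.Prime] [CharP F p]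

omit [Fact p.Prime] [CharP F p] in
theorem charFun_map_unif [∀ d, Fintype (Family F p d)] (d : {d : ℕ // ¬ p ∣ d})
    (X : Family F p d.1 → ℝ) (t : ℝ) :
    charFun ((unif F p d).map X) t = 𝔼 f, Complex.exp ((t * X f : ℝ) * Complex.I) := by
  rw [charFun_apply_real, integral_map (measurable_from_top).aemeasurable (by fun_prop)]
  have h : unif F p d = (PMF.uniformOfFintype (Family F p d.1)).toMeasure := by
    unfold unif
    congr
    exact Subsingleton.elim _ _
  rw [h]
  have : MeasurableSingletonClass (Family F p d.1) := ⟨fun _ => trivial⟩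
  rw [PMF.integral_eq_sum, Fintype.expect_eq_sum_div_card, Finset.sum_div]
  refine Finset.sum_congr rfl fun f _ => ?_
  simp [PMF.uniformOfFintype_apply, div_eq_inv_mul]

/-- Both signs are treated together: the statistic sees `h d` only through its coefficients of index
`1` to `K`. -/
theorem tendstoInDistribution_normalizedSum (hp : Odd p) {ψ : AddChar (ZMod p) ℂ} (hψ : ψ ≠ 1)
    {β : ℕ → ℝ} (hβ : ∀ d, 0 < β d ∧ β d < 1)
    (hregime : (∃ β₀ : ℝ, ∀ d, β d = β₀) ∨
      (Tendsto β atTop (𝓝 0) ∧ Tendsto (fun d : ℕ => (d : ℝ) * β d) atTop atTop))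
    {s : ℝ} (hs : |s| = 1) (h : ℕ → ℝ → ℝ)
    (hh : ∀ d, ∀ k ∈ Finset.Icc 1 (cutoff d (β d)),
      fourierCoefficient (h d) k = selbergCoeff s (cutoff d (β d)) (β d) k) :
    TendstoInDistribution
      (fun (d : {d : ℕ // ¬ p ∣ d}) (f : Family F p d.1) =>
        normalizedSum ψ (h d.1) (cutoff d.1 (β d.1)) d.1 (β d.1) (f : F[X]))
      (comap Subtype.val atTop) (id : ℝ → ℝ) (fun d => unif F p d) (gaussianReal 0 1) := by
  classical
  obtain ⟨hy, c₀, hc₀, hsin⟩ := exists_mul_le_sin hβ hregime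
  let := fun d : ℕ => Fintype.ofFinite (Family F p d)
  have hp2 : 2 ≤ p := (Fact.out : p.Prime).two_le
  have hp3 : 3 ≤ p := by
    obtain ⟨j, rfl⟩ := hp
    omega
  have hp1 : (0 : ℝ) < (p : ℝ) - 1 := by
    have : (3 : ℝ) ≤ p := by exact_mod_cast hp3
    linarith
  set w := (√(Nat.card F : ℝ))⁻¹ with hw
  set K : ℕ → ℕ := fun d => cutoff d (β d) with hK
  set c : ℕ → ℕ → ℝ := fun d => selbergCoeff s (K d) (β d) with hc
  set L : ℕ → ℝ := fun d => Real.log (d * β d) with hLdef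
  set σ : ℕ → ℝ := fun d => √(2 * ((p : ℝ) - 1) / Real.pi ^ 2 * L d) with hσ
  have hL : Tendsto L atTop atTop := Real.tendsto_log_atTop.comp hy
  have hκ : 0 < 2 * ((p : ℝ) - 1) / Real.pi ^ 2 := by positivity
  have hσt : Tendsto σ atTop atTop :=
    Real.tendsto_sqrt_atTop.comp (hL.const_mul_atTop hκ)
  have hck (d : ℕ) : ∀ k ∈ Finset.Icc 1 (K d), k * |c d k| ≤ 3 :=
    fun k hk => mul_abs_selbergCoeff_le hs (β d) hk
  have hconst (M : ℝ) : Tendsto (fun d => M / σ d) atTop (𝓝 0) :=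
    tendsto_const_nhds.div_atTop hσt
  set M₁ : ℝ := 2 * 3 / (1 - w) + 2 * 3 with hM₁
  have hcoeff (d : ℕ) (P : closedPoints F (K d)) : |pointCoeff w (c d) p (K d) P.1.natDegree| ≤ M₁ := by
    have hP := mem_closedPoints.1 P.2
    exact abs_pointCoeff_le (inv_sqrt_card_pos F).le (inv_sqrt_card_lt_one F) (by norm_num) (hck d)
      (by omega) (Finset.mem_Icc.2 ⟨hP.2.1.natDegree_pos, hP.2.2⟩)
  have hcomap : Tendsto (Subtype.val : {d : ℕ // ¬ p ∣ d} → ℕ) (comap Subtype.val atTop) atTop :=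
    tendsto_comap
  set S : ℕ → ℝ := fun d => ∑ P : closedPoints F (K d),
    pointCoeff w (c d) p (K d) P.1.natDegree ^ 2 with hS
  -- The sum of squared weights is `(2 / π ^ 2) log (K β) + O(1)`, and `log (K β)` is asymptotic to
  -- `L`.
  have hSlim : Tendsto (fun d => Real.pi ^ 2 / 2 * (S d / L d)) atTop (𝓝 1) := by
    set M₂ : ℝ := (2 * 3 / (1 - w) * (4 * 3 + 2 * 3 / (1 - w)) + 8 * 3 ^ 2) * (1 / (1 - w))
      + (32 + 4 / Real.pi ^ 2 * (4 * Real.pi ^ 2 + 1 + 1 / c₀)) with hM₂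
    have hdiff : ∀ᶠ d in atTop,
        |S d - 2 / Real.pi ^ 2 * Real.log (K d * β d)| ≤ M₂ := by
      filter_upwards [eventually_cutoff_bounds hβ hy, hsin] with d hd hsd
      have h1 := abs_sum_pointCoeff_sq_sub_le F (p := p) (by norm_num : (0 : ℝ) ≤ 3) (hck d)
      have h2 := abs_variance_sub_log_le hs hc₀ (hβ d).1 (hβ d).2 hsd hd.1
      exact (abs_sub_le _ _ _).trans (add_le_add h1 h2)
    have hzero : Tendsto (fun d => (S d - 2 / Real.pi ^ 2 * Real.log (K d * β d)) / L d) atTop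
        (𝓝 0) := by
      refine squeeze_zero_norm' (a := fun d => M₂ / L d) ?_ (tendsto_const_nhds.div_atTop hL)
      filter_upwards [hdiff, hL.eventually_gt_atTop 0] with d hd hLd
      rw [norm_div, Real.norm_eq_abs, Real.norm_of_nonneg hLd.le]
      gcongr
    have hlim := (hzero.add ((tendsto_log_cutoff hβ hy).const_mul (2 / Real.pi ^ 2))).const_mul
      (Real.pi ^ 2 / 2)
    have hpi := Real.pi_ne_zero
    have hval : Real.pi ^ 2 / 2 * (0 + 2 / Real.pi ^ 2 * 1) = 1 := by field_simp; norm_num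
    rw [hval] at hlim
    refine hlim.congr fun d => ?_
    ring
  refine tendstoInDistribution_of_tendsto_charFun (fun d => measurable_from_top) fun t => ?_
  have hgauss : charFun (gaussianReal 0 1) t = Complex.exp (-(t : ℂ) ^ 2 / 2) := by
    rw [charFun_gaussianReal]
    congr 1
    push_cast
    ring
  rw [hgauss]
  have hmain := tendsto_charFun_of_mixed_moments (l := comap Subtype.val atTop)
    (Ω := fun d : {d : ℕ // ¬ p ∣ d} => Family F p d.1)
    (ι := fun d : {d : ℕ // ¬ p ∣ d} => closedPoints F (K d.1))
    expect_zeroStat expect_zeroStat_sq abs_zeroStat_le hp1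
    (fun d f P => localTrace p P.1 f.1)
    (fun d P => pointCoeff w (c d.1) p (K d.1) P.1.natDegree / σ d.1)
    (ε := fun d => M₁ / σ d.1) (δ := fun d => drift F w (c d.1) p (K d.1) / σ d.1)
    (Eventually.of_forall fun d P => by
      rw [abs_div, abs_of_nonneg (Real.sqrt_nonneg _ : 0 ≤ σ d.1)]
      exact div_le_div_of_nonneg_right (hcoeff d.1 P) (Real.sqrt_nonneg _))
    ((hconst M₁).comp hcomap)
    (by
      refine Tendsto.comp (g := fun d => ((p : ℝ) - 1) * ∑ P : closedPoints F (K d),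
        (pointCoeff w (c d) p (K d) P.1.natDegree / σ d) ^ 2) ?_ hcomap
      -- The variance `p - 1` of `zeroStat` cancels the same factor in `σ d ^ 2`.
      refine hSlim.congr' ?_
      filter_upwards [hL.eventually_gt_atTop 0] with d hLd
      have hσ2 : σ d ^ 2 = 2 * ((p : ℝ) - 1) / Real.pi ^ 2 * L d :=
        Real.sq_sqrt (mul_pos hκ hLd).le
      simp only [div_pow]
      rw [← Finset.sum_div, hσ2]
      have hpi := Real.pi_ne_zero
      field_simp
      rfl)
    (by
      refine Tendsto.comp (g := fun d => drift F w (c d) p (K d) / σ d) ?_ hcomap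
      refine squeeze_zero_norm (fun d => ?_) (hconst (2 * 3 * p * (1 / (1 - w ^ (1 / 3 : ℝ)))))
      rw [norm_div, Real.norm_eq_abs, Real.norm_of_nonneg (Real.sqrt_nonneg _ : 0 ≤ σ d)]
      exact div_le_div_of_nonneg_right (abs_drift_le F hp3 (hck d) (by norm_num))
        (Real.sqrt_nonneg _))
    -- For each fixed `r` the mixed moments agree exactly once `r * K ≤ d`.
    (fun r => (hcomap.eventually (eventually_mul_cutoff_le hy r)).mono
      fun d hd κ => expect_localTrace d hd (zeroStat p) κ) t
  refine hmain.congr fun d => ?_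
  rw [charFun_map_unif]
  refine Finset.expect_congr rfl fun f _ => ?_
  have hsum : normalizedSum ψ (h d.1) (K d.1) d.1 (β d.1) f.1
      = ∑ P : closedPoints F (K d.1), pointCoeff w (c d.1) p (K d.1) P.1.natDegree / σ d.1
          * zeroStat p (localTrace p P.1 f.1) + drift F w (c d.1) p (K d.1) / σ d.1 := by
    unfold normalizedSum
    rw [curveSum_eq_linear hψ (hh d.1), add_div, Finset.sum_div]
    congr 1
    exact Finset.sum_congr rfl fun P _ => by ring
  rw [hsum]

end Limit

end ArtinSchreier

theorem mainTheorem6 {F : Type*} [Field F] [Finite F] {p : ℕ} [Fact p.Prime] [CharP F p]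
    (hp : Odd p) (ψ : AddChar (ZMod p) ℂ) (hψ : ψ ≠ 1) (β : ℕ → ℝ)
    (hβ : ∀ d, 0 < β d ∧ β d < 1)
    (hregime : (∃ β₀ : ℝ, ∀ d, β d = β₀) ∨
      (Tendsto β atTop (𝓝 0) ∧ Tendsto (fun d : ℕ => (d : ℝ) * β d) atTop atTop)) :
    TendstoInDistribution
        (fun (d : {d : ℕ // ¬ p ∣ d}) (f : ArtinSchreier.Family F p d.1) =>
          ArtinSchreier.normalizedSum ψ
            (ArtinSchreier.selbergPlus (ArtinSchreier.cutoff d.1 (β d.1)) (β d.1))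
            (ArtinSchreier.cutoff d.1 (β d.1)) d.1 (β d.1) (f : Polynomial F))
        (comap Subtype.val atTop) (id : ℝ → ℝ)
        (fun d => ArtinSchreier.unif F p d) (gaussianReal 0 1) ∧
      TendstoInDistribution
        (fun (d : {d : ℕ // ¬ p ∣ d}) (f : ArtinSchreier.Family F p d.1) =>
          ArtinSchreier.normalizedSum ψ
            (ArtinSchreier.selbergMinus (ArtinSchreier.cutoff d.1 (β d.1)) (β d.1))
            (ArtinSchreier.cutoff d.1 (β d.1)) d.1 (β d.1) (f : Polynomial F))
        (comap Subtype.val atTop) (id : ℝ → ℝ)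
        (fun d => ArtinSchreier.unif F p d) (gaussianReal 0 1) := by
  exact ⟨ArtinSchreier.tendstoInDistribution_normalizedSum hp hψ hβ hregime abs_one
      (fun d => ArtinSchreier.selbergPlus (ArtinSchreier.cutoff d (β d)) (β d))
      fun d _ hk => ArtinSchreier.fourierCoefficient_selbergPlus (β d) hk,
    ArtinSchreier.tendstoInDistribution_normalizedSum hp hψ hβ hregime (by simp)
      (fun d => ArtinSchreier.selbergMinus (ArtinSchreier.cutoff d (β d)) (β d))
      fun d _ hk => ArtinSchreier.fourierCoefficient_selbergMinus (β d) hk⟩
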